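/- **Definitions.** A graph $E=(E^0,E^1,\mathbf r,\mathbf s)$ consists of sets $E^0$ (vertices), $E^1$ (edges) and maps $\mathbf s,\mathbf r:E^1\to E^0$ (source, range). A sink is a vertex $v$ with $\mathbf s^{-1}(v)=\emptyset$; $v$ is regular if $\mathbf s^{-1}(v)$ is finite and nonempty; $E$ is row-finite if every $\mathbf s^{-1}(v)$ is finite. Paths are finite sequences $e_1\cdots e_n$ of edges with $\mathbf r(e_i)=\mathbf s(e_{i+1})$, of length $n$; vertices are the paths of length $0$. Infinite paths are infinite sequences $e_1e_2\cdots$ of edges with the same property. Condition (Y): for every natural number $n$ and every infinite path $p$ in $E$ there are an initial subpath $x$ of $p$ and a path $y$ in $E$ with $\mathbf r(y)=\mathbf r(x)$ and $|y|-|x|=n$. The graph inverse semigroup $\mathcal S(E)$ is the semigroup with zero generated by $E^0\cup E^1\cup\{e^{-1}: e\in E^1\}$ subject to $vw=\delta_{v,w}v$, $\mathbf s(e)e=e\,\mathbf r(e)=e$, $\mathbf r(e)e^{-1}=e^{-1}\mathbf s(e)=e^{-1}$ and $e^{-1}f=\delta_{e,f}\mathbf r(e)$ for $v,w\in E^0$,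 $e,f\in E^1$. Its nonzero elements are uniquely of the form $xy^{-1}$ with $x,y$ paths and $\mathbf r(x)=\mathbf r(y)$. In the natural $\mathbb Z$-grading, $\mathcal S(E)_n$ consists of $0$ and the $xy^{-1}$ with $|x|-|y|=n$. For a field $K$, let $K[\mathcal S(E)]$ be the contracted semigroup ring (the zero of $\mathcal S(E)$ is identified with $0$), and let $L_K(E)$ be its quotient by the ideal generated by all $v-\sum_{e\in\mathbf s^{-1}(v)}ee^{-1}$ with $v$ a regular vertex. The natural $\mathbb Z$-grading of $L_K(E)$ has as component of degree $n$ the image of the $K$-span of $\mathcal S(E)_n$. A $\mathbb Z$-graded ring $A=\bigoplus_n A_n$ is strongly graded if $A_mA_n=A_{m+n}$ for all $m,n\in\mathbb Z$, where $A_mA_n$ is the set of all finite sums of products $ab$ with $a\in A_m$, $b\in A_n$. For an inverse semigroup $S$ with zero, $E(S)$ denotes its set of idempotents, and $s\le t$ means $s=tu$ for some $u\in E(S)$. Minimality and maximality of idempotents refer to $\le$. Suppose that $S=\bigcup_{\alpha\in\mathbb Z}S_\alpha$ is $\mathbb Z$-graded, and put $E(S)_\alpha=\{ss^{-1}: s\in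 S_\alpha\}$. Then $S$ is locally strongly graded if for all $\alpha,\beta\in\mathbb Z$ and $s\in S_{\alpha+\beta}\setminus\{0\}$ there is $t\in S_\alpha S_\beta\setminus\{0\}$ with $t\le s$. It is saturated strongly graded if for every $\alpha\in\mathbb Z$ and every infinite strictly descending chain $u_0>u_1>\cdots$ of idempotents in $S$ with $u_0$ a maximal idempotent, there exist $n\ge 0$ and $v\in E(S)_\alpha$ such that $u_0\ge v\ge u_n$. **Theorem.** Let $E$ be a nonempty graph. Then the following are equivalent. 1. $E$ has no sinks, is row-finite, and satisfies condition (Y). 2. For every field $K$, $L_K(E)$ is strongly graded in the natural $\mathbb Z$-grading. 3. There are no minimal idempotents in $\mathcal S(E)\setminus\{0\}$; for every maximal idempotent $u$ in $\mathcal S(E)$ there are only finitely many maximal elements in the set of idempotents $\{v\in E(\mathcal S(E)) : v<u\}$; and $\mathcal S(E)$ is saturated strongly graded in the natural $\mathbb Z$-grading. 4. For every maximal idempotent $u$ in $\mathcal S(E)$ there are only finitely many maximal elements in the set of idempotents $\{v\in E(\mathcal S(E)) : v<u\}$; and $\mathcal S(E)$ is both locally strongly graded and saturated strongly graded in the natural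 $\mathbb Z$-grading. -/

import Mathlib

universe u v w

open Quiver

/-! ### Graded semigroups with zero -/

namespace GradedSemigroup

variable {S : Type*} [SemigroupWithZero S]

/-- The natural partial order: `s ≤ t` iff `s = t * e` for some idempotent `e`. -/
def NatLE (s t : S) : Prop := ∃ e : S, IsIdempotentElem e ∧ s = t * e

/-- The strict natural order. -/
def NatLT (s t : S) : Prop := NatLE s t ∧ s ≠ t

/-- `t` is an inverse of `s`; in an inverse semigroup this says exactly `t = s⁻¹`. -/
def IsInverse (s t : S) : Prop := s * t * s = s ∧ t * s * t = t

/-- `u` is a maximal idempotent of `S` with respect to the natural order. -/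
def IsMaximalIdempotent (u : S) : Prop :=
  IsIdempotentElem u ∧ ∀ e : S, IsIdempotentElem e → ¬ NatLT u e

/-- `u` is minimal among the nonzero idempotents of `S` with respect to the natural order. -/
def IsMinimalNonzeroIdempotent (u : S) : Prop :=
  (IsIdempotentElem u ∧ u ≠ 0) ∧ ∀ e : S, IsIdempotentElem e → e ≠ 0 → ¬ NatLT e u

/-- The maximal elements of the set of idempotents strictly below `u`. -/
def maximalIdempotentsBelow (u : S) : Set S :=
  {x | (IsIdempotentElem x ∧ NatLT x u) ∧
    ∀ y : S, IsIdempotentElem y → NatLT y u → ¬ NatLT x y}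

variable (S) in
/-- Strictly below every maximal idempotent there are only finitely many maximal idempotents. -/
def MaximalIdempotentFiniteness : Prop :=
  ∀ u : S, IsMaximalIdempotent u → (maximalIdempotentsBelow u).Finite

variable {Γ : Type*} [AddGroup Γ]

/-- The family `A` of subsets is a grading of `S` by the (additively written) group `Γ`. -/
def IsGrading (A : Γ → Set S) : Prop :=
  (∀ s : S, ∃ α, s ∈ A α) ∧
  (∀ α β : Γ, ∀ s ∈ A α, ∀ t ∈ A β, s * t ∈ A (α + β)) ∧
  (∀ α β : Γ, α ≠ β → A α ∩ A β = {0})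

/-- The set of all `s s⁻¹` with `s` in the component of degree `α`. -/
def idempotentsOfDegree (A : Γ → Set S) (α : Γ) : Set S :=
  {x | ∃ s ∈ A α, ∃ t : S, IsInverse s t ∧ x = s * t}

/-- `S` (an inverse semigroup) is locally strongly graded by `A`. -/
def LocallyStronglyGraded (A : Γ → Set S) : Prop :=
  IsGrading A ∧
  ∀ α β : Γ, ∀ s ∈ A (α + β), s ≠ 0 →
    ∃ a ∈ A α, ∃ b ∈ A β, a * b ≠ 0 ∧ NatLE (a * b) s

/-- `S` (an inverse semigroup) is saturated strongly graded by `A`. -/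
def SaturatedStronglyGraded (A : Γ → Set S) : Prop :=
  IsGrading A ∧
  ∀ (α : Γ) (c : ℕ → S), (∀ i, IsIdempotentElem (c i)) → (∀ i, NatLT (c (i + 1)) (c i)) →
    IsMaximalIdempotent (c 0) →
    ∃ (n : ℕ) (x : S), x ∈ idempotentsOfDegree A α ∧ NatLE x (c 0) ∧ NatLE (c n) x

end GradedSemigroup

/-! ### Strongly graded (not necessarily unital) rings -/

/-- `R` is the internal direct sum of the `A α`, and `A α * A β = A (α + β)` for all `α`, `β`,
where `A α * A β` is the additive subgroup generated by the products. -/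
def IsStronglyGradedRing {R : Type*} [NonUnitalRing R] {Γ : Type*} [AddGroup Γ] [DecidableEq Γ]
    (A : Γ → AddSubgroup R) : Prop :=
  DirectSum.IsInternal A ∧
  ∀ α β : Γ, AddSubgroup.closure {c : R | ∃ a ∈ A α, ∃ b ∈ A β, c = a * b} = A (α + β)

/-- The quotient ring of a not necessarily unital ring by a two-sided ideal. -/
def TwoSidedIdeal.QuotientRing {R : Type*} [NonUnitalRing R] (I : TwoSidedIdeal R) : Type _ :=
  I.ringCon.Quotient

instance {R : Type*} [NonUnitalRing R] (I : TwoSidedIdeal R) : NonUnitalRing I.QuotientRing :=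
  inferInstanceAs (NonUnitalRing I.ringCon.Quotient)

/-- The quotient map of a not necessarily unital ring by a two-sided ideal. -/
def TwoSidedIdeal.quotientMap {R : Type*} [NonUnitalRing R] (I : TwoSidedIdeal R) :
    R →ₙ+* I.QuotientRing where
  toFun r := (r : I.ringCon.Quotient)
  map_mul' _ _ := rfl
  map_zero' := rfl
  map_add' _ _ := rfl

section ContractedSemigroupRing

variable (K : Type*) [Field K] (S : Type*) [SemigroupWithZero S]

/-- The ideal of the semigroup ring `K S` generated by the zero of `S`. -/
noncomputable def contractedIdeal : TwoSidedIdeal (MonoidAlgebra K S) :=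
  TwoSidedIdeal.span {MonoidAlgebra.single (0 : S) (1 : K)}

/-- The contracted semigroup ring `K[S]`: the zero of `S` is identified with the zero element. -/
abbrev ContractedSemigroupRing : Type _ := (contractedIdeal K S).QuotientRing

variable {S} in
/-- The element `k s` of `K[S]`. -/
noncomputable def ContractedSemigroupRing.single (s : S) (k : K) : ContractedSemigroupRing K S :=
  (contractedIdeal K S).quotientMap (MonoidAlgebra.single s k)

variable {S} in
/-- The grading of `K[S]` induced by a grading `A` of `S`: the component of degree `α` consists of
the linear combinations of elements of `A α`. -/
noncomputable def ContractedSemigroupRing.component {Γ : Type*} (A : Γ → Set S) (α : Γ) :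
    AddSubgroup (ContractedSemigroupRing K S) :=
  AddSubgroup.closure {a | ∃ s ∈ A α, ∃ k : K, a = ContractedSemigroupRing.single K s k}

end ContractedSemigroupRing

/-! ### Graphs

A graph is a quiver: the vertices are the elements of `V`, an edge `e` with source `a` and range `b`
is an element of `a ⟶ b`; `Quiver.Total V` is the set of all edges and `Quiver.Star a` the set of
edges with source `a`. Finite paths are `Quiver.Path a b`, those of length `0` being the vertices. -/

namespace DirectedGraph

variable (V : Type u) [Quiver.{v} V]

variable {V} in
/-- A vertex that emits no edge. -/
def IsSink (a : V) : Prop := IsEmpty (Star a)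

variable {V} in
/-- A vertex that emits a nonzero finite number of edges. -/
def IsRegular (a : V) : Prop := Nonempty (Star a) ∧ Finite (Star a)

/-- Every vertex emits only finitely many edges. -/
def RowFinite : Prop := ∀ a : V, Finite (Star a)

/-- An infinite path: `edge i` goes from `vertex i` to `vertex (i + 1)`. -/
structure InfinitePath where
  vertex : ℕ → V
  edge : ∀ i, vertex i ⟶ vertex (i + 1)

variable {V} in
/-- The initial subpath consisting of the first `k` edges. -/
def InfinitePath.initial (p : InfinitePath V) : ∀ k : ℕ, Path (p.vertex 0) (p.vertex k)
  | 0 => Path.nil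
  | k + 1 => (InfinitePath.initial p k).cons (p.edge k)

/-- Condition (Y): for every `n` and every infinite path `p` there are an initial subpath `x` of `p`
and a path `y` with the same range as `x` such that `|y| - |x| = n`. -/
def ConditionY : Prop :=
  ∀ (n : ℕ) (p : InfinitePath V), ∃ (k : ℕ) (a : V) (y : Path a (p.vertex k)),
    (y.length : ℤ) - ((p.initial k).length : ℤ) = n

/-! ### The graph inverse semigroup -/

/-- The generators: vertices, edges `e`, and symbols `e⁻¹`. -/
inductive Generator : Type (max u v)
  | vertex (a : V) : Generator
  | edge {a b : V} (e : a ⟶ b) : Generator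
  | ghost {a b : V} (e : a ⟶ b) : Generator

/-- The free semigroup with zero on the generators. -/
abbrev Word : Type (max u v) := WithZero (FreeSemigroup (Generator V))

variable {V} in
/-- A generator as a word. -/
def Word.of (g : Generator V) : Word V := ((FreeSemigroup.of g : FreeSemigroup (Generator V)) : Word V)

open Generator in
/-- The defining relations. -/
inductive Relation : Word V → Word V → Prop
  | vertex_same (a : V) : Relation (.of (vertex a) * .of (vertex a)) (.of (vertex a))
  | vertex_ne (a b : V) (h : a ≠ b) : Relation (.of (vertex a) * .of (vertex b)) 0
  | source_edge {a b : V} (e : a ⟶ b) : Relation (.of (vertex a) * .of (edge e)) (.of (edge e))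
  | edge_range {a b : V} (e : a ⟶ b) : Relation (.of (edge e) * .of (vertex b)) (.of (edge e))
  | range_ghost {a b : V} (e : a ⟶ b) : Relation (.of (vertex b) * .of (ghost e)) (.of (ghost e))
  | ghost_source {a b : V} (e : a ⟶ b) : Relation (.of (ghost e) * .of (vertex a)) (.of (ghost e))
  | ghost_edge_same {a b : V} (e : a ⟶ b) :
      Relation (.of (ghost e) * .of (edge e)) (.of (vertex b))
  | ghost_edge_ne {a b c d : V} (e : a ⟶ b) (f : c ⟶ d)
      (h : (Total.mk a b e : Total V) ≠ Total.mk c d f) :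
      Relation (.of (ghost e) * .of (edge f)) 0

/-- The graph inverse semigroup: the semigroup with zero given by the generators and relations. -/
def GraphInverseSemigroup : Type (max u v) := (conGen (Relation V)).Quotient

namespace GraphInverseSemigroup

variable {V} in
/-- The class of a word. -/
def mk (x : Word V) : GraphInverseSemigroup V := (x : (conGen (Relation V)).Quotient)

instance : SemigroupWithZero (GraphInverseSemigroup V) where
  __ := (inferInstance : Semigroup (conGen (Relation V)).Quotient)
  zero := mk 0
  zero_mul := by
    rintro ⟨x⟩
    exact congrArg mk (zero_mul x)
  mul_zero := by
    rintro ⟨x⟩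
    exact congrArg mk (mul_zero x)

variable {V}

/-- The element given by a vertex. -/
def vertex (a : V) : GraphInverseSemigroup V := mk (.of (.vertex a))

/-- The element given by an edge `e`. -/
def edge {a b : V} (e : a ⟶ b) : GraphInverseSemigroup V := mk (.of (.edge e))

/-- The element `e⁻¹`. -/
def ghost {a b : V} (e : a ⟶ b) : GraphInverseSemigroup V := mk (.of (.ghost e))

/-- The element `e₁ ⋯ eₙ` given by a path. -/
def path {a : V} : ∀ {b : V}, Path a b → GraphInverseSemigroup V
  | _, .nil => vertex a
  | _, .cons x e => path x * edge e

/-- The element `eₙ⁻¹ ⋯ e₁⁻¹` given by a path. -/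
def invPath {a : V} : ∀ {b : V}, Path a b → GraphInverseSemigroup V
  | _, .nil => vertex a
  | _, .cons x e => ghost e * invPath x

variable (V) in
/-- The natural `ℤ`-grading: the component of degree `n` consists of `0` and of the elements
`x y⁻¹`, where `x` and `y` are paths with the same range and `|x| - |y| = n`. -/
def naturalGrading (n : ℤ) : Set (GraphInverseSemigroup V) :=
  {s | s = 0 ∨ ∃ (a b c : V) (x : Path a c) (y : Path b c),
    s = path x * invPath y ∧ (x.length : ℤ) - (y.length : ℤ) = n}

end GraphInverseSemigroup

/-! ### Cohn and Leavitt path algebras -/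

variable (K : Type w) [Field K]

/-- The Cohn path algebra: the contracted semigroup ring of the graph inverse semigroup. -/
abbrev CohnPathAlgebra : Type _ := ContractedSemigroupRing K (GraphInverseSemigroup V)

variable {V} in
/-- The element `a - ∑ e e⁻¹` of the Cohn path algebra, the sum being over all edges `e` with
source `a`; it is used only where these are finite in number. -/
noncomputable def cuntzKriegerElement (a : V) : CohnPathAlgebra V K :=
  ContractedSemigroupRing.single K (GraphInverseSemigroup.vertex a) 1 -
    ∑ᶠ e : Star a, ContractedSemigroupRing.single K
      (GraphInverseSemigroup.edge e.2 * GraphInverseSemigroup.ghost e.2) 1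

/-- The ideal generated by the elements `a - ∑ e e⁻¹`, for `a` a regular vertex. -/
noncomputable def cuntzKriegerIdeal : TwoSidedIdeal (CohnPathAlgebra V K) :=
  TwoSidedIdeal.span {x | ∃ a : V, IsRegular a ∧ x = cuntzKriegerElement K a}

/-- The Leavitt path algebra. -/
abbrev LeavittPathAlgebra : Type _ := (cuntzKriegerIdeal V K).QuotientRing

/-- The natural `ℤ`-grading of the Leavitt path algebra, induced by that of the graph inverse
semigroup. -/
noncomputable def leavittGrading (n : ℤ) : AddSubgroup (LeavittPathAlgebra V K) :=
  (ContractedSemigroupRing.component K (GraphInverseSemigroup.naturalGrading V) n).map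
    ((cuntzKriegerIdeal V K).quotientMap : CohnPathAlgebra V K →+ LeavittPathAlgebra V K)

end DirectedGraph

open GradedSemigroup DirectedGraph

/-!
A nonzero element of the graph inverse semigroup is uniquely of the form `x y⁻¹`, and a nonzero
idempotent is uniquely of the form `x x⁻¹`, where `x x⁻¹ ≤ y y⁻¹` means that `y` is an initial
subpath of `x`. So the maximal idempotents are the vertices, the maximal idempotents strictly below
a vertex that is not a sink correspond to the edges it emits, the minimal nonzero idempotents belong
to the paths that end in a sink, and a strictly descending chain of idempotents that starts at a
vertex follows an infinite path. This turns the conditions on idempotents into the absence of sinks,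
row-finiteness and condition (Y). A locally strong grading excludes sinks, because an element of
degree `1` begins with an edge; conversely, without sinks and with condition (Y), an element `x y⁻¹`
lies above some `(x z q⁻¹) (q z⁻¹ y⁻¹)` where `z` is an initial subpath of an infinite path.

Uniqueness of the normal form, and the fact that vertices do not vanish in the Leavitt path algebra,
both come from representations on branching systems (`BranchingSystem.rep`): on the space with basis
`V × κ`, an edge `e : a ⟶ b` sends `(b, t)` to `(a, branch e t)`. Lists of edges give a
representation in which `z z⁻¹` is a vertex only for trivial `z`; a system whose branches cover `κ`
at every vertex that is not a sink satisfies the Cuntz–Krieger relations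
(`BranchingSystem.exists_covering`, `leavittSingle_vertex_ne_zero`).

Suppose that there are no sinks, that the graph is row-finite, and that condition (Y) holds. Then
repeated use of the Cuntz–Krieger relations writes each vertex as a sum of idempotents `z z⁻¹` for
which a path `q` of prescribed length `|q| = |z| + m` ends where `z` ends; the process terminates,
because otherwise it would run along an infinite path that violates (Y)
(`vertex_mem_balancedSpan`). Inserting `z z⁻¹ = (z q⁻¹) (q z⁻¹)` between `x` and `y⁻¹` shows that
the grading is strong. Conversely, if the grading is strong, then a vertex `a` lies in
`L_α L_{-α}`, so it is killed by every `t` that kills a certain finite set of elements of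
degree `α`; but for a path `x` starting at `a`, the product `x⁻¹ a` is nonzero
(`exists_finset_of_isStronglyGradedRing`). For `α = 1` this excludes sinks and infinite emitters,
and for `α = -n`, with `x` running through the initial subpaths of an infinite path, it gives (Y).
-/

namespace DirectedGraph

namespace GraphInverseSemigroup

variable {V : Type u} [Quiver.{v} V]

/-! ### The defining relations and the normal form -/

lemma mk_eq_of_relation {x y : Word V} (h : Relation V x y) : mk x = mk y :=
  (Con.eq _).2 (ConGen.Rel.of _ _ h)

@[simp] lemma vertex_mul_vertex (a : V) : vertex a * vertex a = vertex a :=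
  mk_eq_of_relation (.vertex_same a)

lemma vertex_mul_vertex_of_ne {a b : V} (h : a ≠ b) : vertex a * vertex b = 0 :=
  mk_eq_of_relation (.vertex_ne a b h)

@[simp] lemma vertex_mul_edge {a b : V} (e : a ⟶ b) : vertex a * edge e = edge e :=
  mk_eq_of_relation (.source_edge e)

@[simp] lemma edge_mul_vertex {a b : V} (e : a ⟶ b) : edge e * vertex b = edge e :=
  mk_eq_of_relation (.edge_range e)

@[simp] lemma vertex_mul_ghost {a b : V} (e : a ⟶ b) : vertex b * ghost e = ghost e :=
  mk_eq_of_relation (.range_ghost e)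

@[simp] lemma ghost_mul_vertex {a b : V} (e : a ⟶ b) : ghost e * vertex a = ghost e :=
  mk_eq_of_relation (.ghost_source e)

@[simp] lemma ghost_mul_edge {a b : V} (e : a ⟶ b) : ghost e * edge e = vertex b :=
  mk_eq_of_relation (.ghost_edge_same e)

lemma ghost_mul_edge_of_ne {a b c d : V} {e : a ⟶ b} {f : c ⟶ d}
    (h : (Total.mk a b e : Total V) ≠ Total.mk c d f) : ghost e * edge f = 0 :=
  mk_eq_of_relation (.ghost_edge_ne e f h)

@[simp] lemma path_nil (a : V) : path (Path.nil : Path a a) = vertex a := rfl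

@[simp] lemma invPath_nil (a : V) : invPath (Path.nil : Path a a) = vertex a := rfl

lemma path_cons {a b c : V} (x : Path a b) (e : b ⟶ c) : path (x.cons e) = path x * edge e := rfl

lemma invPath_cons {a b c : V} (x : Path a b) (e : b ⟶ c) :
    invPath (x.cons e) = ghost e * invPath x := rfl

@[simp] lemma vertex_mul_path {a b : V} (x : Path a b) : vertex a * path x = path x := by
  induction x with
  | nil => simp
  | cons x e ih => rw [path_cons, ← mul_assoc, ih]

@[simp] lemma path_mul_vertex {a b : V} (x : Path a b) : path x * vertex b = path x := by
  cases x with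
  | nil => simp
  | cons x e => rw [path_cons, mul_assoc, edge_mul_vertex]

@[simp] lemma vertex_mul_invPath {a b : V} (x : Path a b) : vertex b * invPath x = invPath x := by
  cases x with
  | nil => simp
  | cons x e => rw [invPath_cons, ← mul_assoc, vertex_mul_ghost]

@[simp] lemma invPath_mul_vertex {a b : V} (x : Path a b) : invPath x * vertex a = invPath x := by
  induction x with
  | nil => simp
  | cons x e ih => rw [invPath_cons, mul_assoc, ih]

@[simp] lemma invPath_mul_path {a b : V} (x : Path a b) : invPath x * path x = vertex b := by
  induction x with
  | nil => simp
  | cons x e ih =>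
    rw [invPath_cons, path_cons, mul_assoc, ← mul_assoc _ (path x), ih, vertex_mul_edge,
      ghost_mul_edge]

lemma vertex_mul_path_of_ne {a b c : V} (h : a ≠ b) (x : Path b c) : vertex a * path x = 0 := by
  rw [← vertex_mul_path x, ← mul_assoc, vertex_mul_vertex_of_ne h, zero_mul]

lemma invPath_mul_vertex_of_ne {a b c : V} (h : a ≠ c) (x : Path a b) :
    invPath x * vertex c = 0 := by
  rw [← invPath_mul_vertex x, mul_assoc, vertex_mul_vertex_of_ne h, mul_zero]

@[simp] lemma path_toPath {a b : V} (e : a ⟶ b) : path e.toPath = edge e := vertex_mul_edge e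

@[simp] lemma invPath_toPath {a b : V} (e : a ⟶ b) : invPath e.toPath = ghost e :=
  ghost_mul_vertex e

lemma path_comp {a b c : V} (x : Path a b) (y : Path b c) :
    path (x.comp y) = path x * path y := by
  induction y with
  | nil => simp
  | cons y e ih => rw [Path.comp_cons, path_cons, ih, path_cons, mul_assoc]

lemma invPath_comp {a b c : V} (x : Path a b) (y : Path b c) :
    invPath (x.comp y) = invPath y * invPath x := by
  induction y with
  | nil => simp
  | cons y e ih => rw [Path.comp_cons, invPath_cons, ih, invPath_cons, mul_assoc]

end GraphInverseSemigroup

lemma path_eq_nil_or_eq_toPath_comp {V : Type u} [Quiver.{v} V] {a b : V} (x : Path a b) :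
    (∃ h : a = b, h ▸ (Path.nil : Path a a) = x) ∨
      ∃ (c : V) (e : a ⟶ c) (y : Path c b), x = e.toPath.comp y := by
  induction x with
  | nil => exact .inl ⟨rfl, rfl⟩
  | cons x e ih =>
    right
    rcases ih with ⟨rfl, rfl⟩ | ⟨c, f, y, rfl⟩
    · exact ⟨_, e, .nil, rfl⟩
    · exact ⟨c, f, y.cons e, rfl⟩

namespace GraphInverseSemigroup

variable {V : Type u} [Quiver.{v} V]

/-- Two paths are either comparable in the prefix order or orthogonal. -/
lemma invPath_mul_path_cases {a b c d : V} (x : Path a c) (y : Path b d) :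
    invPath x * path y = 0 ∨
      (∃ z : Path c d, (⟨b, y⟩ : Σ b, Path b d) = ⟨a, x.comp z⟩) ∨
      ∃ z : Path d c, (⟨a, x⟩ : Σ a, Path a c) = ⟨b, y.comp z⟩ := by
  induction x with
  | nil =>
    by_cases h : a = b
    · subst h
      exact .inr (.inl ⟨y, by rw [Path.nil_comp]⟩)
    · exact .inl (vertex_mul_path_of_ne h y)
  | cons x e ih =>
    rcases ih with h | ⟨z, h⟩ | ⟨z, h⟩
    · exact .inl (by rw [invPath_cons, mul_assoc, h, mul_zero])
    · cases h
      rcases path_eq_nil_or_eq_toPath_comp z with ⟨rfl, rfl⟩ | ⟨c', f, z', rfl⟩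
      · exact .inr (.inr ⟨e.toPath, rfl⟩)
      · by_cases hef : Total.mk _ _ e = Total.mk _ _ f
        · cases hef
          exact .inr (.inl ⟨z', by rw [← Path.comp_assoc]; rfl⟩)
        · left
          rw [invPath_cons, path_comp, path_comp, mul_assoc, ← mul_assoc (invPath x),
            invPath_mul_path, path_toPath, ← mul_assoc, ← mul_assoc, ghost_mul_vertex,
            ghost_mul_edge_of_ne hef, zero_mul]
    · cases h
      exact .inr (.inr ⟨z.cons e, rfl⟩)

lemma invPath_mul_path_comp {a b c : V} (x : Path a b) (z : Path b c) :
    invPath x * path (x.comp z) = path z := by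
  rw [path_comp, ← mul_assoc, invPath_mul_path, vertex_mul_path]

lemma invPath_comp_mul_path {a b c : V} (x : Path a b) (z : Path b c) :
    invPath (x.comp z) * path x = invPath z := by
  rw [invPath_comp, mul_assoc, invPath_mul_path, invPath_mul_vertex]

/-- The product of two elements `x y⁻¹` is zero or again of this form, and lengths behave as
expected. -/
lemma mul_normalForm {a b c a' b' c' : V} (x : Path a c) (y : Path b c) (x' : Path a' c')
    (y' : Path b' c') :
    path x * invPath y * (path x' * invPath y') = 0 ∨
      ∃ (d : V) (p : Path a d) (q : Path b' d),
        path x * invPath y * (path x' * invPath y') = path p * invPath q ∧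
        (p.length : ℤ) - q.length = (x.length - y.length) + (x'.length - y'.length) := by
  have hmul : path x * invPath y * (path x' * invPath y') =
      path x * (invPath y * path x') * invPath y' := by simp only [mul_assoc]
  rw [hmul]
  rcases invPath_mul_path_cases y x' with h | ⟨z, h⟩ | ⟨z, h⟩
  · exact .inl (by rw [h, mul_zero, zero_mul])
  · cases h
    refine .inr ⟨_, x.comp z, y', ?_, ?_⟩
    · rw [invPath_mul_path_comp, path_comp]
    · simp only [Path.length_comp]; push_cast; ring
  · cases h
    refine .inr ⟨_, x, y'.comp z, ?_, ?_⟩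
    · rw [invPath_comp_mul_path, invPath_comp, mul_assoc]
    · simp only [Path.length_comp]; push_cast; ring

/-- Every element is zero or of the form `x y⁻¹`. -/
lemma eq_zero_or_exists (s : GraphInverseSemigroup V) :
    s = 0 ∨ ∃ (a b c : V) (x : Path a c) (y : Path b c), s = path x * invPath y := by
  have key : ∀ w : FreeSemigroup (Generator V), mk (w : Word V) = 0 ∨
      ∃ (a b c : V) (x : Path a c) (y : Path b c), mk (w : Word V) = path x * invPath y := by
    intro w
    have hof : ∀ g : Generator V, mk (.of g) = 0 ∨
      ∃ (a b c : V) (x : Path a c) (y : Path b c), mk (.of g) = path x * invPath y := by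
      rintro (a | @⟨a, b, e⟩ | @⟨a, b, e⟩)
      · exact .inr ⟨a, a, a, .nil, .nil, (vertex_mul_vertex a).symm⟩
      · exact .inr ⟨a, b, b, e.toPath, .nil, by
          rw [path_toPath, invPath_nil, edge_mul_vertex]; rfl⟩
      · exact .inr ⟨b, a, b, .nil, e.toPath, by
          rw [invPath_toPath, path_nil, vertex_mul_ghost]; rfl⟩
    induction w using FreeSemigroup.recOnMul with
    | ih1 g => exact hof g
    | ih2 g w _ ih =>
      have : mk (((FreeSemigroup.of g * w : FreeSemigroup (Generator V))) : Word V)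
        = mk (.of g) * mk (w : Word V) := rfl
      rw [this]
      rcases hof g with h | ⟨a, b, c, x, y, h⟩
      · exact .inl (by rw [h, zero_mul])
      · rcases ih with h' | ⟨a', b', c', x', y', h'⟩
        · exact .inl (by rw [h', mul_zero])
        · rw [h, h']
          rcases mul_normalForm x y x' y' with h'' | ⟨d, p, q, h'', -⟩
          · exact .inl h''
          · exact .inr ⟨_, _, _, p, q, h''⟩
  obtain ⟨w, rfl⟩ := Quotient.exists_rep s
  induction w using WithZero.recZeroCoe with
  | zero => exact .inl rfl
  | coe w => exact key w

/-! ### Representations on branching systems -/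

/-- The extension of a map on generators to words. -/
noncomputable def wordLift {M : Type*} [SemigroupWithZero M] (f : Generator V → M) :
    Word V →ₙ* M where
  toFun x := WithZero.recZeroCoe (0 : M) (fun w => FreeSemigroup.lift f w) x
  map_mul' x y := by
    induction x using WithZero.recZeroCoe with
    | zero => simp
    | coe x =>
      induction y using WithZero.recZeroCoe with
      | zero => simp
      | coe y =>
        rw [← WithZero.coe_mul]
        simp only [WithZero.recZeroCoe_coe, map_mul]

/-- The homomorphism on the graph inverse semigroup induced by a map on generators that respects
the defining relations. -/
noncomputable def lift {M : Type*} [SemigroupWithZero M] (f : Generator V → M)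
    (hf : ∀ x y, Relation V x y → wordLift f x = wordLift f y) :
    GraphInverseSemigroup V →ₙ* M where
  toFun s := Con.liftOn s (wordLift f) fun x y h =>
    (Con.conGen_le (c := Con.ker (wordLift f))).2 (fun _ _ h => hf _ _ h) h
  map_mul' := by
    rintro ⟨x⟩ ⟨y⟩
    exact map_mul (wordLift f) x y

end GraphInverseSemigroup
end DirectedGraph

namespace DirectedGraph

open GraphInverseSemigroup

variable {V : Type u} [Quiver.{v} V]

/-- A branching system on a type `κ`: every edge `e` acts on `κ` by an injective map `branch e`, and
the maps given by distinct edges with the same source have disjoint ranges. The pairs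
`(a, t) : V × κ` are thought of as boundary paths starting at `a`, and an edge `e : a ⟶ b` prolongs
`(b, t)` to `(a, branch e t)`. -/
structure BranchingSystem (V : Type u) [Quiver.{v} V] (κ : Type*) where
  branch : ∀ {a b : V}, (a ⟶ b) → κ → κ
  inj : ∀ {a b c : V} (e : a ⟶ b) (f : a ⟶ c) (s t : κ), branch e s = branch f t →
    (⟨b, e⟩ : Star a) = ⟨c, f⟩ ∧ s = t

namespace BranchingSystem

variable {κ : Type*} (B : BranchingSystem V κ) (K : Type w) [Field K]

open Classical in
/-- The projection onto the span of the pairs with first entry `a`. -/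
noncomputable def vertexOp (_ : BranchingSystem V κ) (a : V) : Module.End K (V × κ →₀ K) :=
  Finsupp.linearCombination K fun p => if p.1 = a then Finsupp.single p 1 else 0

open Classical in
/-- The operator of prolongation by the edge `e`. -/
noncomputable def edgeOp {a b : V} (e : a ⟶ b) : Module.End K (V × κ →₀ K) :=
  Finsupp.linearCombination K fun p =>
    if p.1 = b then Finsupp.single (a, B.branch e p.2) 1 else 0

open Classical in
/-- The operator that removes the edge `e`, and annihilates the pairs that do not start
with `e`. -/
noncomputable def ghostOp {a b : V} (e : a ⟶ b) : Module.End K (V × κ →₀ K) :=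
  Finsupp.linearCombination K fun p =>
    if h : ∃ t, p = (a, B.branch e t) then Finsupp.single (b, h.choose) 1 else 0

lemma vertexOp_single (a : V) (t : κ) :
    B.vertexOp K a (Finsupp.single (a, t) 1) = Finsupp.single (a, t) 1 := by
  simp [vertexOp]

lemma vertexOp_single_of_ne {a c : V} (h : c ≠ a) (t : κ) :
    B.vertexOp K a (Finsupp.single (c, t) 1) = 0 := by
  simp [vertexOp, h]

lemma edgeOp_single {a b : V} (e : a ⟶ b) (t : κ) :
    B.edgeOp K e (Finsupp.single (b, t) 1) = Finsupp.single (a, B.branch e t) 1 := by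
  simp [edgeOp]

lemma edgeOp_single_of_ne {a b c : V} (e : a ⟶ b) (h : c ≠ b) (t : κ) :
    B.edgeOp K e (Finsupp.single (c, t) 1) = 0 := by
  simp [edgeOp, h]

lemma ghostOp_single {a b : V} (e : a ⟶ b) (t : κ) :
    B.ghostOp K e (Finsupp.single (a, B.branch e t) 1) = Finsupp.single (b, t) 1 := by
  have h : ∃ t', ((a, B.branch e t) : V × κ) = (a, B.branch e t') := ⟨t, rfl⟩
  have h' : h.choose = t := (B.inj e e _ _ (Prod.ext_iff.1 h.choose_spec).2).2.symm
  simp only [ghostOp, Finsupp.linearCombination_single, one_smul, dif_pos h, h']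

lemma ghostOp_single_of_not {a b : V} (e : a ⟶ b) {p : V × κ}
    (h : ¬ ∃ t, p = (a, B.branch e t)) : B.ghostOp K e (Finsupp.single p 1) = 0 := by
  simp only [ghostOp, Finsupp.linearCombination_single, one_smul, dif_neg h]

/-- The operator of a generator. -/
noncomputable def op : Generator V → Module.End K (V × κ →₀ K)
  | .vertex a => B.vertexOp K a
  | .edge e => B.edgeOp K e
  | .ghost e => B.ghostOp K e

lemma end_ext {X : Type*} {f g : Module.End K (X × κ →₀ K)}
    (h : ∀ c t, f (Finsupp.single (c, t) 1) = g (Finsupp.single (c, t) 1)) : f = g :=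
  Finsupp.lhom_ext' fun ⟨c, t⟩ => LinearMap.ext_ring (h c t)

lemma wordLift_op_of_relation {x y : Word V} (h : Relation V x y) :
    wordLift (B.op K) x = wordLift (B.op K) y := by
  have hof : ∀ g : Generator V, wordLift (B.op K) (.of g) = B.op K g := fun _ => rfl
  have h0 : wordLift (B.op K) (0 : Word V) = 0 := rfl
  induction h with
  | vertex_same a =>
    rw [map_mul, hof]
    refine end_ext K fun c t => ?_
    by_cases hc : c = a
    · subst hc; simp only [op, Module.End.mul_apply, vertexOp_single]
    · simp only [op, Module.End.mul_apply, vertexOp_single_of_ne B K hc, map_zero]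
  | vertex_ne a b hab =>
    rw [map_mul, hof, hof, h0]
    refine end_ext K fun c t => ?_
    by_cases hc : c = b
    · subst hc
      simp only [op, Module.End.mul_apply, vertexOp_single,
        vertexOp_single_of_ne B K hab.symm, LinearMap.zero_apply]
    · simp only [op, Module.End.mul_apply, vertexOp_single_of_ne B K hc, map_zero,
        LinearMap.zero_apply]
  | @source_edge a b e =>
    rw [map_mul, hof, hof]
    refine end_ext K fun c t => ?_
    by_cases hc : c = b
    · subst hc; simp only [op, Module.End.mul_apply, edgeOp_single, vertexOp_single]
    · simp only [op, Module.End.mul_apply, edgeOp_single_of_ne B K e hc, map_zero]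
  | @edge_range a b e =>
    rw [map_mul, hof, hof]
    refine end_ext K fun c t => ?_
    by_cases hc : c = b
    · subst hc; simp only [op, Module.End.mul_apply, edgeOp_single, vertexOp_single]
    · simp only [op, Module.End.mul_apply, vertexOp_single_of_ne B K hc,
        edgeOp_single_of_ne B K e hc, map_zero]
  | @range_ghost a b e =>
    rw [map_mul, hof, hof]
    refine end_ext K fun c t => ?_
    by_cases hc : ∃ t', ((c, t) : V × κ) = (a, B.branch e t')
    · obtain ⟨t', hc⟩ := hc
      simp only [op, Module.End.mul_apply, hc, ghostOp_single, vertexOp_single]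
    · simp only [op, Module.End.mul_apply, ghostOp_single_of_not B K e hc, map_zero]
  | @ghost_source a b e =>
    rw [map_mul, hof, hof]
    refine end_ext K fun c t => ?_
    by_cases hc : c = a
    · subst hc; simp only [op, Module.End.mul_apply, vertexOp_single]
    · have : ¬ ∃ t', ((c, t) : V × κ) = (a, B.branch e t') :=
        fun ⟨t', h⟩ => hc (Prod.ext_iff.1 h).1
      simp only [op, Module.End.mul_apply, vertexOp_single_of_ne B K hc,
        ghostOp_single_of_not B K e this, map_zero]
  | @ghost_edge_same a b e =>
    rw [map_mul, hof, hof, hof]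
    refine end_ext K fun c t => ?_
    by_cases hc : c = b
    · subst hc
      simp only [op, Module.End.mul_apply, edgeOp_single, ghostOp_single, vertexOp_single]
    · simp only [op, Module.End.mul_apply, vertexOp_single_of_ne B K hc,
        edgeOp_single_of_ne B K e hc, map_zero]
  | @ghost_edge_ne a b a' b' e f hef =>
    rw [map_mul, hof, hof, h0]
    refine end_ext K fun c t => ?_
    by_cases hc : c = b'
    · subst hc
      have : ¬ ∃ t', ((a', B.branch f t) : V × κ) = (a, B.branch e t') := by
        rintro ⟨t', h⟩
        obtain ⟨rfl, h⟩ := Prod.ext_iff.1 h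
        obtain ⟨h, -⟩ := B.inj _ _ _ _ h
        cases h
        exact hef rfl
      simp only [op, Module.End.mul_apply, edgeOp_single, ghostOp_single_of_not B K e this,
        LinearMap.zero_apply]
    · simp only [op, Module.End.mul_apply, edgeOp_single_of_ne B K f hc, map_zero,
        LinearMap.zero_apply]

/-- The representation of the graph inverse semigroup on the vector space with basis `V × κ`. -/
noncomputable def rep : GraphInverseSemigroup V →ₙ* Module.End K (V × κ →₀ K) :=
  GraphInverseSemigroup.lift (B.op K) fun _ _ h => B.wordLift_op_of_relation K h

lemma rep_zero : B.rep K 0 = 0 := rfl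

lemma rep_vertex (a : V) : B.rep K (vertex a) = B.vertexOp K a := rfl

lemma rep_edge {a b : V} (e : a ⟶ b) : B.rep K (edge e) = B.edgeOp K e := rfl

lemma rep_ghost {a b : V} (e : a ⟶ b) : B.rep K (ghost e) = B.ghostOp K e := rfl

/-- If the branches of a vertex with finitely many edges cover `κ`, then the Cuntz–Krieger relation
holds at this vertex. -/
lemma rep_vertex_eq_sum {a : V} [Fintype (Star a)]
    (h : ∀ t, ∃ (e : Star a) (t' : κ), t = B.branch e.2 t') :
    B.rep K (vertex a) = ∑ e : Star a, B.rep K (edge e.2 * ghost e.2) := by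
  refine end_ext K fun c t => ?_
  rw [LinearMap.sum_apply]
  simp only [map_mul, rep_vertex, rep_edge, rep_ghost, Module.End.mul_apply]
  by_cases hc : c = a
  · subst hc
    obtain ⟨e, t', rfl⟩ := h t
    rw [vertexOp_single, Finset.sum_eq_single e, ghostOp_single, edgeOp_single]
    · rintro f - hfe
      rw [ghostOp_single_of_not, map_zero]
      rintro ⟨s, h⟩
      exact hfe (B.inj e.2 f.2 _ _ (Prod.ext_iff.1 h).2).1.symm
    · simp
  · rw [vertexOp_single_of_ne B K hc, Finset.sum_eq_zero]
    rintro f -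
    rw [ghostOp_single_of_not, map_zero]
    rintro ⟨s, h⟩
    exact hc (Prod.ext_iff.1 h).1

/-- The branching system of all lists of edges, where an edge acts by prepending. -/
def lists (V : Type u) [Quiver.{v} V] : BranchingSystem V (List (Total V)) where
  branch e l := Total.mk _ _ e :: l
  inj e f s t h := by
    obtain ⟨h1, h2⟩ := List.cons.inj h
    cases h1
    exact ⟨rfl, h2⟩

/-- There is a branching system on some nonempty type in which the branches of every vertex that is
not a sink cover everything. -/
lemma exists_covering (V : Type u) [Quiver.{v} V] :
    ∃ (κ : Type (max u v)) (_ : Nonempty κ) (B : BranchingSystem V κ),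
      ∀ a : V, ¬ IsSink a → ∀ t, ∃ (e : Star a) (t' : κ), t = B.branch e.2 t' := by
  classical
  let κ : Type (max u v) := ℕ ⊕ Total V
  have hκ : ∀ a : V, ¬ IsSink a → Nonempty (Star a × κ ≃ κ) := by
    intro a ha
    rw [IsSink, not_isEmpty_iff] at ha
    have hinf : Cardinal.aleph0 ≤ Cardinal.mk κ := Cardinal.aleph0_le_mk κ
    have hle : Cardinal.mk (Star a) ≤ Cardinal.mk κ := by
      refine Cardinal.mk_le_of_injective (f := fun e => Sum.inr (Total.mk a e.1 e.2)) ?_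
      intro e f h
      have h := Sum.inr_injective h
      cases e; cases f; cases h; rfl
    refine Cardinal.eq.1 ?_
    rw [Cardinal.mk_prod, Cardinal.lift_id, Cardinal.lift_id]
    exact Cardinal.mul_eq_right hinf hle (Cardinal.mk_ne_zero _)
  have ns : ∀ {a b : V} (_ : a ⟶ b), ¬ IsSink a := fun e h => h.false ⟨_, e⟩
  refine ⟨κ, ⟨.inl 0⟩, ⟨fun {a b} e t => (hκ a (ns e)).some (⟨b, e⟩, t), ?_⟩, ?_⟩
  · intro a b c e f s t h
    exact Prod.ext_iff.1 ((hκ a (ns e)).some.injective h)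
  · intro a ha t
    refine ⟨((hκ a ha).some.symm t).1, ((hκ a ha).some.symm t).2, ?_⟩
    exact ((hκ a ha).some.apply_symm_apply t).symm

end BranchingSystem

namespace GraphInverseSemigroup

/-! ### Uniqueness of the normal form -/

lemma vertex_ne_zero (a : V) : vertex a ≠ 0 := by
  intro h
  have h1 := (BranchingSystem.lists V).vertexOp_single ℚ a []
  rw [← BranchingSystem.rep_vertex, h, BranchingSystem.rep_zero] at h1
  simpa using DFunLike.congr_fun h1 (a, [])

lemma path_ne_zero {a b : V} (x : Path a b) : path x ≠ 0 := by
  intro h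
  have := invPath_mul_path x
  rw [h, mul_zero] at this
  exact vertex_ne_zero _ this.symm

lemma path_mul_invPath_ne_zero {a b c : V} (x : Path a c) (y : Path b c) :
    path x * invPath y ≠ 0 := by
  intro h
  have : path x * invPath y * path y = path x := by
    rw [mul_assoc, invPath_mul_path, path_mul_vertex]
  rw [h, zero_mul] at this
  exact path_ne_zero _ this.symm

/-- `x x⁻¹` is a vertex only if `x` has length zero: an edge `e` cannot be removed from the empty
list, so `e⁻¹` kills a vector that is fixed by its source. -/
lemma length_eq_zero_of_path_mul_invPath_eq_vertex {a b c : V} {x : Path a b}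
    (h : path x * invPath x = vertex c) : x.length = 0 := by
  rcases path_eq_nil_or_eq_toPath_comp x with ⟨rfl, rfl⟩ | ⟨d, e, y, rfl⟩
  · rfl
  · exfalso
    have h1 := (BranchingSystem.lists V).vertexOp_single ℚ c []
    rw [← BranchingSystem.rep_vertex, ← h, invPath_comp, invPath_toPath, ← mul_assoc, map_mul,
      Module.End.mul_apply, BranchingSystem.rep_ghost, BranchingSystem.ghostOp_single_of_not,
      map_zero] at h1
    · simpa using DFunLike.congr_fun h1 (c, [])
    · rintro ⟨t, ht⟩
      exact List.cons_ne_nil _ _ (Prod.ext_iff.1 ht).2.symm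

lemma length_eq_zero_of_path_eq_vertex {a b c : V} {x : Path a b} (h : path x = vertex c) :
    x.length = 0 := by
  have h1 : vertex b = invPath x * vertex c := by rw [← h, invPath_mul_path]
  have hca : a = c := by
    by_contra hac
    rw [invPath_mul_vertex_of_ne hac] at h1
    exact vertex_ne_zero _ h1
  subst hca
  rw [invPath_mul_vertex] at h1
  have h2 : path x * invPath x = vertex a := by rw [← h1, path_mul_vertex, h]
  exact length_eq_zero_of_path_mul_invPath_eq_vertex h2

lemma sigma_eq_of_length_eq_zero {a b c : V} (x : Path a b) {z : Path b c} (hz : z.length = 0) :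
    (⟨c, x.comp z⟩ : Σ c, Quiver.Path a c) = ⟨b, x⟩ := by
  cases z with
  | nil => rfl
  | cons z e => simp at hz

lemma path_injective {a b c d : V} {x : Path a b} {y : Path c d} (h : path x = path y) :
    (⟨a, b, x⟩ : Σ a b, Quiver.Path a b) = ⟨c, d, y⟩ := by
  have key : ∀ {a b d : V} {x : Path a b} (z : Path b d), path x = path (x.comp z) →
      (⟨d, x.comp z⟩ : Σ d, Quiver.Path a d) = ⟨b, x⟩ := by
    intro a b d x z h
    refine sigma_eq_of_length_eq_zero x (length_eq_zero_of_path_eq_vertex (c := b) ?_)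
    rw [← invPath_mul_path_comp x z, ← h, invPath_mul_path]
  rcases invPath_mul_path_cases x y with h' | ⟨z, h'⟩ | ⟨z, h'⟩
  · rw [← h, invPath_mul_path] at h'
    exact absurd h' (vertex_ne_zero _)
  · cases h'
    exact congrArg (fun s : Σ d, Quiver.Path a d => (⟨a, s⟩ : Σ a b, Quiver.Path a b)) (key z h).symm
  · cases h'
    exact congrArg (fun s : Σ d, Quiver.Path a d => (⟨a, s⟩ : Σ a b, Quiver.Path a b)) (key z h.symm)

/-- If two normal forms agree and the second path of one prolongs that of the other, then this
prolongation is trivial. -/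
lemma length_eq_zero_of_path_mul_invPath_comp_eq {a a' b c d : V} {x : Path a c} {y : Path b c}
    {z : Path c d} {x' : Path a' d} (h : path x * invPath y = path x' * invPath (y.comp z)) :
    z.length = 0 := by
  have h1 : path x = path x' * invPath z := by
    have := congrArg (· * path y) h
    simpa only [mul_assoc, invPath_mul_path, path_mul_vertex, invPath_comp_mul_path] using this
  have h2 : path x * path z = path x' := by
    rw [h1, mul_assoc, invPath_mul_path, path_mul_vertex]
  have h3 : path x * (path z * invPath z) = path x := by rw [← mul_assoc, h2, h1]
  have h4 := congrArg (invPath x * ·) h3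
  simp only [← mul_assoc, invPath_mul_path, vertex_mul_path] at h4
  exact length_eq_zero_of_path_mul_invPath_eq_vertex h4

/-- The normal form is unique. -/
lemma normalForm_injective {a b c a' b' c' : V} {x : Path a c} {y : Path b c} {x' : Path a' c'}
    {y' : Path b' c'} (h : path x * invPath y = path x' * invPath y') :
    (⟨a, b, c, x, y⟩ : Σ a b c, Quiver.Path a c × Quiver.Path b c) = ⟨a', b', c', x', y'⟩ := by
  have hy : (⟨b, c, y⟩ : Σ b c, Quiver.Path b c) = ⟨b', c', y'⟩ := by
    rcases invPath_mul_path_cases y y' with h' | ⟨z, h'⟩ | ⟨z, h'⟩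
    · exfalso
      have h1 := congrArg (· * path y') h
      simp only [mul_assoc, h', invPath_mul_path, path_mul_vertex, mul_zero] at h1
      exact path_ne_zero _ h1.symm
    · cases h'
      have hz := length_eq_zero_of_path_mul_invPath_comp_eq h
      exact congrArg (fun s : Σ d, Quiver.Path b d => (⟨b, s⟩ : Σ a b, Quiver.Path a b))
        (sigma_eq_of_length_eq_zero y hz).symm
    · cases h'
      have hz := length_eq_zero_of_path_mul_invPath_comp_eq h.symm
      exact congrArg (fun s : Σ d, Quiver.Path b d => (⟨b, s⟩ : Σ a b, Quiver.Path a b))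
        (sigma_eq_of_length_eq_zero _ hz)
  cases hy
  have h1 := congrArg (· * path y) h
  simp only [mul_assoc, invPath_mul_path, path_mul_vertex] at h1
  cases path_injective h1
  rfl

end GraphInverseSemigroup
end DirectedGraph

namespace DirectedGraph

namespace GraphInverseSemigroup

variable {V : Type u} [Quiver.{v} V]

/-! ### The natural grading and the natural order -/

lemma path_mul_invPath_mem_naturalGrading_iff {a b c : V} {x : Path a c} {y : Path b c} {n : ℤ} :
    path x * invPath y ∈ naturalGrading V n ↔ (x.length : ℤ) - y.length = n := by
  constructor
  · rintro (h | ⟨a', b', c', x', y', h, hn⟩)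
    · exact absurd h (path_mul_invPath_ne_zero x y)
    · cases normalForm_injective h
      exact hn
  · exact fun h => .inr ⟨a, b, c, x, y, rfl, h⟩

variable (V) in
lemma isGrading_naturalGrading : IsGrading (naturalGrading V) := by
  refine ⟨fun s => ?_, fun α β s hs t ht => ?_, fun α β hαβ => ?_⟩
  · rcases eq_zero_or_exists s with h | ⟨a, b, c, x, y, h⟩
    · exact ⟨0, .inl h⟩
    · exact ⟨_, .inr ⟨a, b, c, x, y, h, rfl⟩⟩
  · rcases hs with rfl | ⟨a, b, c, x, y, rfl, rfl⟩
    · exact .inl (zero_mul t)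
    · rcases ht with rfl | ⟨a', b', c', x', y', rfl, rfl⟩
      · exact .inl (mul_zero _)
      · rcases mul_normalForm x y x' y' with h | ⟨d, p, q, h, hd⟩
        · exact .inl h
        · exact .inr ⟨_, _, _, p, q, h, hd⟩
  · ext s
    constructor
    · rintro ⟨hs | ⟨a, b, c, x, y, rfl, rfl⟩, ht⟩
      · exact hs
      · exact absurd (path_mul_invPath_mem_naturalGrading_iff.1 ht) hαβ
    · rintro rfl
      exact ⟨.inl rfl, .inl rfl⟩

lemma zero_natLE (s : GraphInverseSemigroup V) : NatLE 0 s := ⟨0, mul_zero 0, (mul_zero s).symm⟩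

lemma eq_zero_of_natLE_zero {s : GraphInverseSemigroup V} (h : NatLE s 0) : s = 0 := by
  obtain ⟨e, -, h⟩ := h
  rw [h, zero_mul]

/-- The idempotent `x x⁻¹` of a path `x`. -/
def proj {a b : V} (x : Path a b) : GraphInverseSemigroup V := path x * invPath x

lemma proj_nil (a : V) : proj (.nil : Path a a) = vertex a := vertex_mul_vertex a

lemma proj_ne_zero {a b : V} (x : Path a b) : proj x ≠ 0 := path_mul_invPath_ne_zero x x

lemma isIdempotentElem_proj {a b : V} (x : Path a b) : IsIdempotentElem (proj x) := by
  rw [IsIdempotentElem, proj, mul_assoc, ← mul_assoc (invPath x), invPath_mul_path,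
    vertex_mul_invPath]

lemma isIdempotentElem_vertex (a : V) : IsIdempotentElem (vertex a) := vertex_mul_vertex a

lemma proj_injective {a b c d : V} {x : Path a b} {y : Path c d} (h : proj x = proj y) :
    (⟨a, b, x⟩ : Σ a b, Quiver.Path a b) = ⟨c, d, y⟩ := by
  cases normalForm_injective h
  rfl

lemma proj_mul_proj_comp {a b c : V} (x : Path a b) (z : Path b c) :
    proj x * proj (x.comp z) = proj (x.comp z) := by
  rw [proj, proj, mul_assoc, ← mul_assoc (invPath x), invPath_mul_path_comp, ← mul_assoc,
    ← path_comp]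

lemma proj_comp_mul_proj {a b c : V} (x : Path a b) (z : Path b c) :
    proj (x.comp z) * proj x = proj (x.comp z) := by
  rw [proj, proj, mul_assoc, ← mul_assoc (invPath _) (path x), invPath_comp_mul_path,
    ← invPath_comp]

lemma isIdempotentElem_iff {s : GraphInverseSemigroup V} :
    IsIdempotentElem s ↔ s = 0 ∨ ∃ (a b : V) (x : Path a b), s = proj x := by
  constructor
  · intro h
    rcases eq_zero_or_exists s with rfl | ⟨a, b, c, x, y, rfl⟩
    · exact .inl rfl
    refine .inr ⟨a, c, x, ?_⟩
    have h' : path x * (invPath y * path x) * invPath y = path x * invPath y := by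
      simpa only [mul_assoc] using h.eq
    rcases invPath_mul_path_cases y x with h1 | ⟨z, h1⟩ | ⟨z, h1⟩
    · rw [h1, mul_zero, zero_mul] at h'
      exact absurd h'.symm (path_mul_invPath_ne_zero x y)
    · cases h1
      rw [invPath_mul_path_comp, ← path_comp] at h'
      have := congrArg (fun s => s.2.2.2.1.length) (normalForm_injective h')
      simp only [Path.length_comp] at this
      have hz : z.length = 0 := by omega
      rw [Path.eq_nil_of_length_zero z hz, Path.comp_nil]
      rfl
    · cases h1
      rw [invPath_comp_mul_path, mul_assoc, ← invPath_comp] at h'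
      have := congrArg (fun s => s.2.2.2.2.length) (normalForm_injective h')
      simp only [Path.length_comp] at this
      have hz : z.length = 0 := by omega
      rw [Path.eq_nil_of_length_zero z hz, Path.comp_nil]
      rfl
  · rintro (rfl | ⟨a, b, x, rfl⟩)
    · exact mul_zero 0
    · exact isIdempotentElem_proj x

/-- `x x⁻¹ ≤ y y⁻¹` if and only if `y` is an initial subpath of `x`. -/
lemma natLE_proj_iff {a b c d : V} {x : Path a c} {y : Path b d} :
    NatLE (proj x) (proj y) ↔
      ∃ z : Path d c, (⟨a, x⟩ : Σ a, Quiver.Path a c) = ⟨b, y.comp z⟩ := by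
  constructor
  · rintro ⟨e, -, h⟩
    have h' : proj y * proj x = proj x := by
      rw [h, ← mul_assoc, (isIdempotentElem_proj y).eq]
    rcases invPath_mul_path_cases y x with h1 | h1 | ⟨z, h1⟩
    · rw [proj, proj, mul_assoc, ← mul_assoc _ (path x), h1, zero_mul, mul_zero] at h'
      exact absurd h'.symm (proj_ne_zero x)
    · exact h1
    · cases h1
      rw [proj_comp_mul_proj] at h'
      have := congrArg (fun s => s.2.2.length) (proj_injective h')
      simp only [Path.length_comp] at this
      have hz : z.length = 0 := by omega
      cases z with
      | nil => exact ⟨.nil, rfl⟩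
      | cons z e => simp at hz
  · rintro ⟨z, h⟩
    cases h
    exact ⟨_, isIdempotentElem_proj _, (proj_mul_proj_comp y z).symm⟩

lemma proj_natLE_vertex {a b : V} (x : Path a b) : NatLE (proj x) (vertex a) := by
  rw [← proj_nil, natLE_proj_iff]
  exact ⟨x, by rw [Path.nil_comp]⟩

lemma natLT_proj_comp {a b c : V} (x : Path a b) {z : Path b c} (hz : z.length ≠ 0) :
    NatLT (proj (x.comp z)) (proj x) := by
  refine ⟨natLE_proj_iff.2 ⟨z, rfl⟩, fun h => hz ?_⟩
  have := congrArg (fun s => s.2.2.length) (proj_injective h)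
  simp only [Path.length_comp] at this
  omega

/-- The idempotents strictly below the one of `y` come from the proper prolongations of `y`. -/
lemma natLT_proj_iff {a b c d : V} {x : Path a c} {y : Path b d} :
    NatLT (proj x) (proj y) ↔
      ∃ z : Path d c, z.length ≠ 0 ∧ (⟨a, x⟩ : Σ a, Quiver.Path a c) = ⟨b, y.comp z⟩ := by
  constructor
  · rintro ⟨h1, h2⟩
    obtain ⟨z, h⟩ := natLE_proj_iff.1 h1
    refine ⟨z, fun hz => h2 ?_, h⟩
    cases h
    cases z with
    | nil => rfl
    | cons z e => simp at hz
  · rintro ⟨z, hz, h⟩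
    cases h
    exact natLT_proj_comp y hz

lemma isMaximalIdempotent_iff [Nonempty V] {u : GraphInverseSemigroup V} :
    IsMaximalIdempotent u ↔ ∃ a, u = vertex a := by
  constructor
  · rintro ⟨h1, h2⟩
    rcases isIdempotentElem_iff.1 h1 with rfl | ⟨a, b, x, rfl⟩
    · obtain ⟨a⟩ := ‹Nonempty V›
      exact absurd ⟨zero_natLE _, (vertex_ne_zero a).symm⟩ (h2 _ (isIdempotentElem_vertex a))
    · refine ⟨a, ?_⟩
      by_contra h
      exact h2 _ (isIdempotentElem_vertex a) ⟨proj_natLE_vertex x, h⟩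
  · rintro ⟨a, rfl⟩
    refine ⟨isIdempotentElem_vertex a, fun e he hlt => ?_⟩
    rcases isIdempotentElem_iff.1 he with rfl | ⟨b, c, y, rfl⟩
    · exact vertex_ne_zero a (eq_zero_of_natLE_zero hlt.1)
    · rw [← proj_nil, natLT_proj_iff] at hlt
      obtain ⟨z, hz, h⟩ := hlt
      have := congrArg (fun s => s.2.length) h
      simp only [Path.length_comp, Path.length_nil] at this
      omega

/-! ### Sinks and row-finiteness in terms of idempotents -/

lemma length_eq_zero_of_isSink {a b : V} (ha : IsSink a) (x : Path a b) : x.length = 0 := by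
  rcases path_eq_nil_or_eq_toPath_comp x with ⟨rfl, rfl⟩ | ⟨c, e, y, rfl⟩
  · rfl
  · exact (ha.false ⟨c, e⟩).elim

lemma isMinimalNonzeroIdempotent_vertex_of_isSink {a : V} (ha : IsSink a) :
    IsMinimalNonzeroIdempotent (vertex a) := by
  refine ⟨⟨isIdempotentElem_vertex a, vertex_ne_zero a⟩, fun e he he0 hlt => ?_⟩
  rcases isIdempotentElem_iff.1 he with rfl | ⟨b, c, y, rfl⟩
  · exact he0 rfl
  · rw [← proj_nil, natLT_proj_iff] at hlt
    obtain ⟨z, hz, -⟩ := hlt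
    exact hz (length_eq_zero_of_isSink ha z)

lemma forall_not_isMinimalNonzeroIdempotent_iff :
    (∀ s : GraphInverseSemigroup V, ¬ IsMinimalNonzeroIdempotent s) ↔ ∀ a : V, ¬ IsSink a := by
  constructor
  · exact fun h a ha => h _ (isMinimalNonzeroIdempotent_vertex_of_isSink ha)
  · rintro h s ⟨⟨hs, hs0⟩, hmin⟩
    rcases isIdempotentElem_iff.1 hs with rfl | ⟨a, b, x, rfl⟩
    · exact hs0 rfl
    · obtain ⟨⟨c, e⟩⟩ := not_isEmpty_iff.1 (h b)
      exact hmin _ (isIdempotentElem_proj _) (proj_ne_zero _)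
        (natLT_proj_comp x (z := e.toPath) one_ne_zero)

lemma maximalIdempotentsBelow_vertex_subset (a : V) :
    maximalIdempotentsBelow (vertex a) ⊆
      {0} ∪ Set.range fun e : Star a => proj e.2.toPath := by
  rintro s ⟨⟨hs, hlt⟩, hmax⟩
  rcases isIdempotentElem_iff.1 hs with rfl | ⟨b, c, y, rfl⟩
  · exact .inl rfl
  · right
    rw [← proj_nil, natLT_proj_iff] at hlt
    obtain ⟨z, hz, h⟩ := hlt
    rw [Path.nil_comp] at h
    cases h
    rcases path_eq_nil_or_eq_toPath_comp z with ⟨rfl, rfl⟩ | ⟨d, e, y', rfl⟩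
    · exact absurd rfl hz
    · refine ⟨⟨d, e⟩, ?_⟩
      by_contra hne
      refine hmax (proj e.toPath) (isIdempotentElem_proj _) ?_
        ⟨natLE_proj_iff.2 ⟨y', rfl⟩, fun h => hne h.symm⟩
      rw [← proj_nil]
      exact natLT_proj_iff.2 ⟨e.toPath, one_ne_zero, by rw [Path.nil_comp]⟩

lemma proj_toPath_mem_maximalIdempotentsBelow {a b : V} (e : a ⟶ b) :
    proj e.toPath ∈ maximalIdempotentsBelow (vertex a) := by
  refine ⟨⟨isIdempotentElem_proj _, ?_⟩, fun s hs hlt hlt' => ?_⟩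
  · rw [← proj_nil]
    exact natLT_proj_iff.2 ⟨e.toPath, one_ne_zero, by rw [Path.nil_comp]⟩
  · rcases isIdempotentElem_iff.1 hs with rfl | ⟨c, d, y, rfl⟩
    · exact proj_ne_zero _ (eq_zero_of_natLE_zero hlt'.1)
    · rw [← proj_nil, natLT_proj_iff] at hlt
      rw [natLT_proj_iff] at hlt'
      obtain ⟨z, hz, h⟩ := hlt
      obtain ⟨z', hz', h'⟩ := hlt'
      have h1 := congrArg (fun s => s.2.length) h
      have h2 := congrArg (fun s => s.2.length) h'
      simp only [Path.length_comp, Path.length_nil, Path.length_toPath] at h1 h2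
      omega

variable (V) in
lemma maximalIdempotentFiniteness_iff_rowFinite [Nonempty V] :
    MaximalIdempotentFiniteness (GraphInverseSemigroup V) ↔ RowFinite V := by
  constructor
  · intro h a
    have hfin := h (vertex a) (isMaximalIdempotent_iff.2 ⟨a, rfl⟩)
    have := hfin.to_subtype
    refine Finite.of_injective (β := maximalIdempotentsBelow (vertex a))
      (fun e : Star a => ⟨proj e.2.toPath, proj_toPath_mem_maximalIdempotentsBelow e.2⟩) ?_
    rintro ⟨b, e⟩ ⟨c, f⟩ h
    cases proj_injective (Subtype.ext_iff.1 h)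
    rfl
  · intro h u hu
    obtain ⟨a, rfl⟩ := isMaximalIdempotent_iff.1 hu
    have := h a
    exact ((Set.finite_singleton 0).union (Set.finite_range _)).subset
      (maximalIdempotentsBelow_vertex_subset a)

end GraphInverseSemigroup

end DirectedGraph

namespace DirectedGraph

variable {V : Type u} [Quiver.{v} V]

/-! ### Infinite paths -/

namespace InfinitePath

@[simp] lemma length_initial (p : InfinitePath V) (k : ℕ) : (p.initial k).length = k := by
  induction k with
  | zero => rfl
  | succ k ih => rw [initial, Path.length_cons, ih]

/-- The range of an initial subpath of an infinite path is determined by its length. -/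
lemma eq_vertex_length (p : InfinitePath V) {k : ℕ} {c : V} {x : Path (p.vertex 0) c}
    {z : Path c (p.vertex k)} (h : p.initial k = x.comp z) : c = p.vertex x.length := by
  have key : ∀ (k : ℕ) {d : V} (z : Path c d),
      (⟨p.vertex k, p.initial k⟩ : Σ d, Quiver.Path (p.vertex 0) d) = ⟨d, x.comp z⟩ →
        c = p.vertex x.length := by
    intro k d z
    induction z generalizing k with
    | nil =>
      intro h
      cases k with
      | zero => cases h; rfl
      | succ k =>
        cases h
        exact congrArg p.vertex (p.length_initial (k + 1)).symm
    | cons z e ih =>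
      intro h
      cases k with
      | zero => exact absurd (congrArg (fun s => s.2.length) h) (by simp [initial])
      | succ k =>
        refine ih k ?_
        rw [initial, Path.comp_cons] at h
        obtain ⟨h1, h2⟩ := Sigma.mk.inj h
        subst h1
        have h2 := eq_of_heq h2
        exact Sigma.ext (Path.obj_eq_of_cons_eq_cons h2) (Path.heq_of_cons_eq_cons h2)
  exact key k z (by rw [h])

/-- Dependent choice for infinite paths. -/
lemma exists_of_forall_exists_edge {P : V → ℕ → Prop} {a : V} (ha : P a 0)
    (h : ∀ b k, P b k → ∃ (c : V) (_ : b ⟶ c), P c (k + 1)) :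
    ∃ p : InfinitePath V, p.vertex 0 = a ∧ ∀ k, P (p.vertex k) k := by
  choose next edge hnext using h
  let s : ∀ k, {b : V // P b k} := fun k =>
    Nat.rec ⟨a, ha⟩ (fun k b => ⟨next b.1 k b.2, hnext b.1 k b.2⟩) k
  exact ⟨⟨fun k => (s k).1, fun k => edge (s k).1 k (s k).2⟩, rfl, fun k => (s k).2⟩

lemma exists_of_no_sinks (h : ∀ a : V, ¬ IsSink a) (a : V) :
    ∃ p : InfinitePath V, p.vertex 0 = a := by
  obtain ⟨p, hp, -⟩ := exists_of_forall_exists_edge (P := fun _ _ => True) (a := a) trivial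
    fun b k _ => by
      obtain ⟨⟨c, e⟩⟩ := not_isEmpty_iff.1 (h b)
      exact ⟨c, e, trivial⟩
  exact ⟨p, hp⟩

/-- A sequence of paths from a fixed vertex, each prolonging the previous one by one edge, consists
of the initial subpaths of an infinite path. -/
lemma exists_initial_eq {a : V} (d : ℕ → V) (u : ∀ k, Path a (d k)) (h0 : (u 0).length = 0)
    (e : ∀ k, d k ⟶ d (k + 1)) (hu : ∀ k, u (k + 1) = (u k).cons (e k)) :
    ∃ p : InfinitePath V, ∀ k,
      (⟨p.vertex 0, p.vertex k, p.initial k⟩ : Σ a b, Quiver.Path a b) = ⟨a, d k, u k⟩ := by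
  let p : InfinitePath V := ⟨d, e⟩
  refine ⟨p, fun k => ?_⟩
  have h : ∀ k, u k = (u 0).comp (p.initial k) := by
    intro k
    induction k with
    | zero => rfl
    | succ k ih => rw [hu, ih]; rfl
  have h' : ∀ {b c : V} (q : Path a b) (x : Path b c), q.length = 0 →
      (⟨b, c, x⟩ : Σ a b, Quiver.Path a b) = ⟨a, c, q.comp x⟩ := by
    intro b c q x hq
    cases q with
    | nil => rw [Path.nil_comp]
    | cons q e => simp at hq
  rw [h k]
  exact h' (u 0) (p.initial k) h0

end InfinitePath

/-- Condition (Y) gives the same statement for negative `n`, where the second path can be taken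
to be a vertex. -/
lemma ConditionY.exists_int (hY : ConditionY V) (n : ℤ) (p : InfinitePath V) :
    ∃ (k : ℕ) (a : V) (y : Path a (p.vertex k)), (y.length : ℤ) - k = n := by
  rcases Int.le_total 0 n with h | h
  · obtain ⟨k, a, y, hy⟩ := hY n.toNat p
    exact ⟨k, a, y, by rw [InfinitePath.length_initial] at hy; omega⟩
  · exact ⟨(-n).toNat, _, .nil, by simp only [Path.length_nil]; omega⟩

/-- A path whose range is that of an initial subpath `x` satisfies the requirement of condition
(Y). -/
lemma exists_path_to_vertex (p : InfinitePath V) {k : ℕ} {b c : V} {x : Path (p.vertex 0) c}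
    {z : Path c (p.vertex k)} (h : p.initial k = x.comp z) (y : Path b c) :
    ∃ (a : V) (y' : Path a (p.vertex x.length)), y'.length = y.length := by
  have hc := p.eq_vertex_length h
  generalize x.length = n at hc
  subst hc
  exact ⟨b, y, rfl⟩

namespace GraphInverseSemigroup

/-! ### Saturated and locally strong gradings -/

lemma mem_idempotentsOfDegree {a b c : V} (x : Path a c) (y : Path b c) :
    proj x ∈ idempotentsOfDegree (naturalGrading V) ((x.length : ℤ) - y.length) := by
  have h : path x * invPath y * (path y * invPath x) = proj x := by
    rw [mul_assoc, ← mul_assoc (invPath y), invPath_mul_path, vertex_mul_invPath, proj]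
  have h' : path y * invPath x * (path x * invPath y) = proj y := by
    rw [mul_assoc, ← mul_assoc (invPath x), invPath_mul_path, vertex_mul_invPath, proj]
  refine ⟨path x * invPath y, .inr ⟨a, b, c, x, y, rfl, rfl⟩, path y * invPath x, ⟨?_, ?_⟩, h.symm⟩
  · rw [h, proj, mul_assoc, ← mul_assoc (invPath x), invPath_mul_path, vertex_mul_invPath]
  · rw [h', proj, mul_assoc, ← mul_assoc (invPath y), invPath_mul_path, vertex_mul_invPath]

/-- The nonzero idempotents `s s⁻¹` with `s` of degree `α` are the `x x⁻¹` for which there is a path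
`y` with the same range as `x` and `|x| - |y| = α`. -/
lemma exists_of_mem_idempotentsOfDegree {α : ℤ} {e : GraphInverseSemigroup V}
    (h : e ∈ idempotentsOfDegree (naturalGrading V) α) (he : e ≠ 0) :
    ∃ (a b c : V) (x : Path a c) (y : Path b c), e = proj x ∧ (x.length : ℤ) - y.length = α := by
  obtain ⟨s, hs, t, ⟨hst, hts⟩, rfl⟩ := h
  rcases hs with rfl | ⟨a, b, c, x, y, rfl, hα⟩
  · exact absurd (zero_mul t) he
  refine ⟨a, b, c, x, y, ?_, hα⟩
  have hidem : IsIdempotentElem (path x * invPath y * t) := by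
    rw [IsIdempotentElem, ← mul_assoc, hst]
  rcases isIdempotentElem_iff.1 hidem with h0 | ⟨a', d, z, hz⟩
  · exact absurd h0 he
  rw [hz]
  -- `x x⁻¹` and `z z⁻¹ = s s⁻¹` fix each other from the left, so each of `x`, `z` prolongs the other
  have h1 : proj z * proj x = proj x := by
    have := congrArg (· * (path y * invPath x)) (hz ▸ hst)
    simp only [mul_assoc] at this
    rwa [← mul_assoc (invPath y), invPath_mul_path, vertex_mul_invPath] at this
  have h2 : proj x * proj z = proj z := by
    rw [← hz, proj, mul_assoc, mul_assoc (path x), ← mul_assoc (invPath x), invPath_mul_path,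
      ← mul_assoc (vertex c), vertex_mul_invPath]
  obtain ⟨w, hw⟩ := natLE_proj_iff.1 ⟨_, isIdempotentElem_proj x, h1.symm⟩
  obtain ⟨w', hw'⟩ := natLE_proj_iff.1 ⟨_, isIdempotentElem_proj z, h2.symm⟩
  cases hw
  have hlen := congrArg (fun s => s.2.length) hw'
  simp only [Path.length_comp] at hlen
  have hw0 : w.length = 0 := by omega
  cases w with
  | nil => rfl
  | cons w e => simp at hw0

/-- Initial subpaths of the same length of the same path coincide. -/
lemma sigma_eq_of_comp_eq {a b b' c : V} {x : Path a b} {x' : Path a b'} {z : Path b c}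
    {z' : Path b' c} (h : x.comp z = x'.comp z') (hl : x.length = x'.length) :
    (⟨b, x⟩ : Σ b, Quiver.Path a b) = ⟨b', x'⟩ := by
  rcases invPath_mul_path_cases x x' with h0 | ⟨w, hw⟩ | ⟨w, hw⟩
  · have := invPath_mul_path_comp x z
    rw [h, path_comp, ← mul_assoc, h0, zero_mul] at this
    exact absurd this.symm (path_ne_zero z)
  · obtain rfl : x' = x.comp w := eq_of_heq (Sigma.mk.inj hw).2
    rw [Path.length_comp] at hl
    exact (sigma_eq_of_length_eq_zero x (by omega)).symm
  · obtain rfl : x = x'.comp w := eq_of_heq (Sigma.mk.inj hw).2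
    rw [Path.length_comp] at hl
    exact sigma_eq_of_length_eq_zero x' (by omega)

/-- A strictly descending chain of idempotents below a vertex follows an infinite path. -/
lemma exists_infinitePath_of_chain {c : ℕ → GraphInverseSemigroup V}
    (hc : ∀ i, IsIdempotentElem (c i)) (hlt : ∀ i, NatLT (c (i + 1)) (c i)) {a : V}
    (h0 : c 0 = vertex a) :
    ∃ p : InfinitePath V, vertex (p.vertex 0) = c 0 ∧ ∀ i, NatLE (c i) (proj (p.initial i)) := by
  have hne : ∀ i, c i ≠ 0 := by
    intro i hi
    have h := hlt i
    rw [hi] at h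
    exact h.2 (eq_zero_of_natLE_zero h.1)
  have hx : ∀ i, ∃ (b : V) (x : Path a b), c i = proj x ∧ i ≤ x.length := by
    intro i
    induction i with
    | zero => exact ⟨a, .nil, by rw [h0, proj_nil], le_rfl⟩
    | succ i ih =>
      obtain ⟨b, x, hx, hi⟩ := ih
      rcases isIdempotentElem_iff.1 (hc (i + 1)) with h | ⟨a', b', x', h⟩
      · exact absurd h (hne _)
      · have hl := hlt i
        rw [h, hx, natLT_proj_iff] at hl
        obtain ⟨z, hz, hl⟩ := hl
        cases hl
        refine ⟨_, _, h, ?_⟩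
        rw [Path.length_comp]
        omega
  choose b x hcx hxl using hx
  have hu : ∀ i, ∃ (d : V) (u : Path a d) (w : Path d (b i)), x i = u.comp w ∧ u.length = i :=
    fun i => by
      obtain ⟨d, u, w, h, hl⟩ := Path.exists_eq_comp_of_le_length (x i) (hxl i)
      exact ⟨d, u, w, h, hl⟩
  choose d u w hxu hul using hu
  -- `u i` is the initial subpath of length `i` of `x i`, hence also of `x (i + 1)`
  have he : ∀ i, ∃ e : d i ⟶ d (i + 1), u (i + 1) = (u i).cons e := by
    intro i
    have hl := (hlt i).1
    rw [hcx, hcx, natLE_proj_iff] at hl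
    obtain ⟨z, hl⟩ := hl
    have hl : x (i + 1) = (x i).comp z := eq_of_heq (Sigma.mk.inj hl).2
    rw [hxu i, hxu (i + 1)] at hl
    have hlen := hul (i + 1)
    revert hl hlen
    generalize u (i + 1) = v
    generalize w (i + 1) = w'
    intro hl hlen
    cases v with
    | nil => simp at hlen
    | cons v f =>
      have hcomp : v.comp (f.toPath.comp w') = (u i).comp ((w i).comp z) := by
        rw [← Path.comp_assoc, ← Path.comp_assoc, ← hl]
        rfl
      have hlen' : v.length = (u i).length := by
        rw [Path.length_cons] at hlen
        rw [hul i]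
        omega
      have hs := sigma_eq_of_comp_eq hcomp hlen'
      revert hs
      generalize u i = u'
      intro hs
      cases hs
      exact ⟨f, rfl⟩
  choose e he using he
  obtain ⟨p, hp⟩ := InfinitePath.exists_initial_eq d u (hul 0) e he
  refine ⟨p, ?_, fun i => ?_⟩
  · rw [h0, show p.vertex 0 = a from congrArg (fun s => s.1) (hp 0)]
  · have : proj (p.initial i) = proj (u i) :=
      congrArg (fun s : Σ a b, Quiver.Path a b => proj s.2.2) (hp i)
    rw [this, hcx, natLE_proj_iff]
    exact ⟨w i, by rw [hxu]⟩

variable (V) in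
lemma saturatedStronglyGraded_iff_conditionY [Nonempty V] :
    SaturatedStronglyGraded (naturalGrading V) ↔ ConditionY V := by
  constructor
  · rintro ⟨-, h⟩ n p
    obtain ⟨m, e, he, he0, hem⟩ := h (-n) (fun i => proj (p.initial i))
      (fun i => isIdempotentElem_proj _)
      (fun i => natLT_proj_comp (p.initial i) (z := (p.edge i).toPath) one_ne_zero)
      (isMaximalIdempotent_iff.2 ⟨p.vertex 0, proj_nil _⟩)
    have hne : e ≠ 0 := by
      rintro rfl
      exact proj_ne_zero _ (eq_zero_of_natLE_zero hem)
    obtain ⟨a, b, c, x, y, rfl, hxy⟩ := exists_of_mem_idempotentsOfDegree he hne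
    obtain ⟨z, hz⟩ := natLE_proj_iff.1 hem
    obtain ⟨rfl, hz⟩ := Sigma.mk.inj hz
    obtain ⟨a', y', hy'⟩ := exists_path_to_vertex p (eq_of_heq hz) y
    exact ⟨_, a', y', by rw [InfinitePath.length_initial]; omega⟩
  · refine fun hY => ⟨isGrading_naturalGrading V, fun α c hc hlt hmax => ?_⟩
    obtain ⟨a, ha⟩ := isMaximalIdempotent_iff.1 hmax
    obtain ⟨p, hp0, hp⟩ := exists_infinitePath_of_chain hc hlt ha
    obtain ⟨k, b, y, hy⟩ := hY.exists_int (-α) p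
    refine ⟨k, proj (p.initial k), ?_, ?_, hp k⟩
    · have h := mem_idempotentsOfDegree (p.initial k) y
      rwa [InfinitePath.length_initial, show (k : ℤ) - y.length = α by omega] at h
    · rw [← hp0]
      exact proj_natLE_vertex _

/-- At a sink `a`, no element of degree `1` can be a left factor of a nonzero element below `a`. -/
lemma vertex_mul_eq_zero_of_isSink {a : V} (ha : IsSink a) {s : GraphInverseSemigroup V}
    (hs : s ∈ naturalGrading V 1) : vertex a * s = 0 := by
  rcases hs with rfl | ⟨b, c, d, x, y, rfl, hxy⟩
  · exact mul_zero _
  · by_cases hab : a = b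
    · subst hab
      have := length_eq_zero_of_isSink ha x
      omega
    · rw [← mul_assoc, vertex_mul_path_of_ne hab, zero_mul]

lemma not_isSink_of_locallyStronglyGraded (h : LocallyStronglyGraded (naturalGrading V)) (a : V) :
    ¬ IsSink a := by
  intro ha
  have hv : vertex a ∈ naturalGrading V (1 + -1) :=
    .inr ⟨a, a, a, .nil, .nil, (vertex_mul_vertex a).symm, rfl⟩
  obtain ⟨s, hs, t, -, hst, e, -, hle⟩ := h.2 1 (-1) _ hv (vertex_ne_zero a)
  have : vertex a * (s * t) = s * t := by rw [hle, ← mul_assoc, vertex_mul_vertex]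
  rw [← mul_assoc, vertex_mul_eq_zero_of_isSink ha hs, zero_mul] at this
  exact hst this.symm

lemma locallyStronglyGraded_of_conditionY (hs : ∀ a : V, ¬ IsSink a) (hY : ConditionY V) :
    LocallyStronglyGraded (naturalGrading V) := by
  refine ⟨isGrading_naturalGrading V, fun α β s hs' hs0 => ?_⟩
  rcases hs' with rfl | ⟨a, b, c, x, y, rfl, hxy⟩
  · exact absurd rfl hs0
  obtain ⟨p, rfl⟩ := InfinitePath.exists_of_no_sinks hs c
  obtain ⟨k, d, q, hq⟩ := hY.exists_int (x.length - α) p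
  have hz := p.length_initial k
  have hprod : path (x.comp (p.initial k)) * invPath q * (path q * invPath (y.comp (p.initial k))) =
      path (x.comp (p.initial k)) * invPath (y.comp (p.initial k)) := by
    rw [mul_assoc, ← mul_assoc (invPath q), invPath_mul_path, vertex_mul_invPath]
  refine ⟨path (x.comp (p.initial k)) * invPath q, .inr ⟨_, _, _, _, _, rfl, ?_⟩,
    path q * invPath (y.comp (p.initial k)), .inr ⟨_, _, _, _, _, rfl, ?_⟩, ?_,
    proj (y.comp (p.initial k)), isIdempotentElem_proj _, ?_⟩
  · rw [Path.length_comp]; omega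
  · rw [Path.length_comp]; omega
  · rw [hprod]; exact path_mul_invPath_ne_zero _ _
  · rw [hprod, proj, mul_assoc, ← mul_assoc (invPath y), invPath_mul_path_comp, ← mul_assoc,
      path_comp x]

end GraphInverseSemigroup

end DirectedGraph

/-! ### Quotients of non-unital rings and contracted semigroup rings -/

namespace TwoSidedIdeal

variable {R : Type*} [NonUnitalRing R] (I : TwoSidedIdeal R)

lemma quotientMap_surjective : Function.Surjective I.quotientMap := Quotient.exists_rep

lemma quotientMap_eq_zero_iff {r : R} : I.quotientMap r = 0 ↔ r ∈ I :=
  (RingCon.eq I.ringCon).trans (I.mem_iff r).symm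

lemma exists_addMonoidHom_quotientMap {M : Type*} [AddCommGroup M] (f : R →+ M)
    (hf : ∀ r ∈ I, f r = 0) : ∃ g : I.QuotientRing →+ M, ∀ r, g (I.quotientMap r) = f r := by
  let q : R →+ I.QuotientRing := (I.quotientMap : R →+ I.QuotientRing)
  have hq : Function.Surjective q := I.quotientMap_surjective
  refine ⟨q.liftOfSurjective hq ⟨f, fun r hr => ?_⟩, fun r => ?_⟩
  · exact hf r (I.quotientMap_eq_zero_iff.1 hr)
  · exact AddMonoidHom.liftOfRightInverse_comp_apply q _ (Function.rightInverse_surjInv hq) _ r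

end TwoSidedIdeal

namespace ContractedSemigroupRing

variable (K : Type*) [Field K] {S : Type*} [SemigroupWithZero S]

lemma single_add (s : S) (k l : K) : single K s (k + l) = single K s k + single K s l := by
  rw [single, MonoidAlgebra.single_add, map_add]; rfl

lemma single_zero (s : S) : single K s 0 = 0 := by
  rw [single, MonoidAlgebra.single_zero, map_zero]

/-- The additive map `k ↦ k s`. -/
noncomputable def singleHom (s : S) : K →+ ContractedSemigroupRing K S where
  toFun := single K s
  map_zero' := single_zero K s
  map_add' := single_add K s

lemma single_mul_single (s t : S) (k l : K) :
    single K s k * single K t l = single K (s * t) (k * l) := by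
  rw [single, single, single, ← map_mul, MonoidAlgebra.single_mul_single]

variable {K} in
lemma exists_eq_single_zero_of_mem_contractedIdeal {r : MonoidAlgebra K S}
    (hr : r ∈ contractedIdeal K S) : ∃ k : K, r = MonoidAlgebra.single 0 k := by
  let J : TwoSidedIdeal (MonoidAlgebra K S) :=
    TwoSidedIdeal.mk' {r | ∃ k : K, r = MonoidAlgebra.single 0 k}
      ⟨0, (MonoidAlgebra.single_zero _).symm⟩
      (by rintro _ _ ⟨k, rfl⟩ ⟨l, rfl⟩; exact ⟨k + l, (MonoidAlgebra.single_add _ _ _).symm⟩)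
      (by rintro _ ⟨k, rfl⟩; exact ⟨-k, (MonoidAlgebra.single_neg _ _).symm⟩)
      (by
        rintro x _ ⟨k, rfl⟩
        induction x using MonoidAlgebra.induction_linear with
        | zero => exact ⟨0, by rw [zero_mul, MonoidAlgebra.single_zero]⟩
        | add x y hx hy =>
          obtain ⟨l, hl⟩ := hx
          obtain ⟨l', hl'⟩ := hy
          exact ⟨l + l', by rw [add_mul, hl, hl', MonoidAlgebra.single_add]⟩
        | single s l => exact ⟨l * k, by rw [MonoidAlgebra.single_mul_single, mul_zero]⟩)
      (by
        rintro _ x ⟨k, rfl⟩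
        induction x using MonoidAlgebra.induction_linear with
        | zero => exact ⟨0, by rw [mul_zero, MonoidAlgebra.single_zero]⟩
        | add x y hx hy =>
          obtain ⟨l, hl⟩ := hx
          obtain ⟨l', hl'⟩ := hy
          exact ⟨l + l', by rw [mul_add, hl, hl', MonoidAlgebra.single_add]⟩
        | single s l => exact ⟨k * l, by rw [MonoidAlgebra.single_mul_single, zero_mul]⟩)
  have hle : contractedIdeal K S ≤ J := by
    refine TwoSidedIdeal.span_le.2 ?_
    rintro _ rfl
    exact (TwoSidedIdeal.mem_mk' _ _ _ _ _ _ _).2 ⟨1, rfl⟩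
  have h := (TwoSidedIdeal.mem_mk' _ _ _ _ _ _ r).1 (hle hr)
  exact h

@[simp] lemma single_zero_left (k : K) : single K (0 : S) k = 0 := by
  refine (contractedIdeal K S).quotientMap_eq_zero_iff.2 ?_
  have h := (contractedIdeal K S).mul_mem_left (MonoidAlgebra.single (0 : S) k) _
    (TwoSidedIdeal.subset_span (Set.mem_singleton (MonoidAlgebra.single (0 : S) (1 : K))))
  rwa [MonoidAlgebra.single_mul_single, mul_zero, mul_one] at h

variable {K} in
lemma induction_linear {P : ContractedSemigroupRing K S → Prop} (x : ContractedSemigroupRing K S)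
    (zero : P 0) (add : ∀ x y, P x → P y → P (x + y)) (single : ∀ s k, P (single K s k)) : P x := by
  obtain ⟨r, rfl⟩ := (contractedIdeal K S).quotientMap_surjective x
  induction r using MonoidAlgebra.induction_linear with
  | zero => rwa [map_zero]
  | add x y hx hy => rw [map_add]; exact add _ _ hx hy
  | single s k => exact single s k

variable {K} in
/-- An additive map out of the contracted semigroup ring can be prescribed on the elements `k s`,
as long as it is additive in `k` and vanishes for `s = 0`. -/
lemma exists_addMonoidHom {M : Type*} [AddCommGroup M] (f : S → K →+ M) (hf : f 0 = 0) :
    ∃ g : ContractedSemigroupRing K S →+ M, ∀ s k, g (single K s k) = f s k := by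
  let g : MonoidAlgebra K S →+ M :=
    (Finsupp.liftAddHom f).comp MonoidAlgebra.coeffAddEquiv.toAddMonoidHom
  have hg : ∀ s k, g (MonoidAlgebra.single s k) = f s k := fun s k => by
    simp [g]
  obtain ⟨g', hg'⟩ := (contractedIdeal K S).exists_addMonoidHom_quotientMap g (by
    intro r hr
    obtain ⟨k, rfl⟩ := exists_eq_single_zero_of_mem_contractedIdeal hr
    rw [hg, hf, AddMonoidHom.zero_apply])
  exact ⟨g', fun s k => (hg' _).trans (hg s k)⟩

/-- The multiplicative extension of a zero-preserving semigroup representation. -/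
lemma exists_nonUnitalRingHom {R : Type*} [Ring R] [Algebra K R] (f : S →ₙ* R) (hf : f 0 = 0) :
    ∃ g : ContractedSemigroupRing K S →ₙ+* R, ∀ s k, g (single K s k) = k • f s := by
  obtain ⟨g, hg⟩ := exists_addMonoidHom (K := K) (S := S)
    (fun s => ((LinearMap.toSpanSingleton K R (f s)).toAddMonoidHom : K →+ R))
    (by ext; simp [hf])
  have hg : ∀ s k, g (single K s k) = k • f s := fun s k => (hg s k).trans rfl
  refine ⟨{ g with map_mul' := fun x y => ?_, map_zero' := g.map_zero }, hg⟩
  change g (x * y) = g x * g y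
  induction x using induction_linear with
  | zero => simp
  | add x x' hx hx' => rw [add_mul, map_add, hx, hx', map_add, add_mul]
  | single s k =>
    induction y using induction_linear with
    | zero => simp
    | add y y' hy hy' => rw [mul_add, map_add, hy, hy', map_add, mul_add]
    | single t l =>
      rw [single_mul_single, hg, hg, hg, map_mul, smul_mul_smul_comm]

lemma exists_projection (B : Set S) :
    ∃ π : ContractedSemigroupRing K S →+ ContractedSemigroupRing K S, ∀ s k,
      (s ∈ B → π (single K s k) = single K s k) ∧ (s ∉ B → π (single K s k) = 0) := by
  classical
  obtain ⟨π, hπ⟩ := exists_addMonoidHom (K := K) (fun s => if s ∈ B then singleHom K s else 0) (by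
    ext k
    split_ifs
    · exact single_zero_left K k
    · rfl)
  refine ⟨π, fun s k => ⟨fun hs => ?_, fun hs => ?_⟩⟩
  · rw [hπ, if_pos hs]; rfl
  · rw [hπ, if_neg hs]; rfl

/-- The projection of the contracted semigroup ring to the span of the elements in a subset `B` of
the semigroup, along the span of the other elements. -/
noncomputable def projection (B : Set S) :
    ContractedSemigroupRing K S →+ ContractedSemigroupRing K S :=
  (exists_projection K B).choose

lemma projection_single_of_mem {B : Set S} {s : S} (hs : s ∈ B) (k : K) :
    projection K B (single K s k) = single K s k :=
  ((exists_projection K B).choose_spec s k).1 hs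

lemma projection_single_of_notMem {B : Set S} {s : S} (hs : s ∉ B) (k : K) :
    projection K B (single K s k) = 0 :=
  ((exists_projection K B).choose_spec s k).2 hs

variable {Γ : Type*} [AddGroup Γ] {A : Γ → Set S}

lemma projection_single_mul (hA : IsGrading A) {d : Γ} {s : S} (hs : s ∈ A d) (k : K) (n : Γ)
    (x : ContractedSemigroupRing K S) :
    projection K (A n) (single K s k * x) = single K s k * projection K (A (-d + n)) x := by
  induction x using induction_linear with
  | zero => simp
  | add x y hx hy => rw [mul_add, map_add, hx, hy, map_add, mul_add]
  | single t l =>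
    rw [single_mul_single]
    by_cases ht : t ∈ A (-d + n)
    · have hst : s * t ∈ A n := by simpa using hA.2.1 _ _ s hs t ht
      rw [projection_single_of_mem K ht, projection_single_of_mem K hst, single_mul_single]
    · rw [projection_single_of_notMem K ht, mul_zero]
      by_cases hst : s * t ∈ A n
      · obtain ⟨m, hm⟩ := hA.1 t
        have hne : n ≠ d + m := by rintro rfl; exact ht (by simpa using hm)
        have h0 : s * t ∈ A n ∩ A (d + m) := ⟨hst, hA.2.1 _ _ s hs t hm⟩
        rw [hA.2.2 _ _ hne] at h0
        rw [h0, single_zero_left, map_zero]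
      · rw [projection_single_of_notMem K hst]

lemma projection_mul_single (hA : IsGrading A) {d : Γ} {s : S} (hs : s ∈ A d) (k : K) (n : Γ)
    (x : ContractedSemigroupRing K S) :
    projection K (A n) (x * single K s k) = projection K (A (n - d)) x * single K s k := by
  induction x using induction_linear with
  | zero => simp
  | add x y hx hy => rw [add_mul, map_add, hx, hy, map_add, add_mul]
  | single t l =>
    rw [single_mul_single]
    by_cases ht : t ∈ A (n - d)
    · have hst : t * s ∈ A n := by simpa using hA.2.1 _ _ t ht s hs
      rw [projection_single_of_mem K ht, projection_single_of_mem K hst, single_mul_single]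
    · rw [projection_single_of_notMem K ht, zero_mul]
      by_cases hst : t * s ∈ A n
      · obtain ⟨m, hm⟩ := hA.1 t
        have hne : n ≠ m + d := by rintro rfl; exact ht (by simpa using hm)
        have h0 : t * s ∈ A n ∩ A (m + d) := ⟨hst, hA.2.1 _ _ t hm s hs⟩
        rw [hA.2.2 _ _ hne] at h0
        rw [h0, single_zero_left, map_zero]
      · rw [projection_single_of_notMem K hst]

end ContractedSemigroupRing

namespace DirectedGraph

open GraphInverseSemigroup

variable {V : Type u} [Quiver.{v} V] (K : Type w) [Field K]

/-! ### The grading of the Leavitt path algebra -/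

/-- The image of `k s` in the Leavitt path algebra. -/
noncomputable def leavittSingle (s : GraphInverseSemigroup V) (k : K) : LeavittPathAlgebra V K :=
  (cuntzKriegerIdeal V K).quotientMap (ContractedSemigroupRing.single K s k)

lemma leavittSingle_mul (s t : GraphInverseSemigroup V) (k l : K) :
    leavittSingle K s k * leavittSingle K t l = leavittSingle K (s * t) (k * l) := by
  rw [leavittSingle, leavittSingle, ← map_mul, ContractedSemigroupRing.single_mul_single]; rfl

lemma leavittSingle_zero (k : K) : leavittSingle K (0 : GraphInverseSemigroup V) k = 0 := by
  rw [leavittSingle, ContractedSemigroupRing.single_zero_left, map_zero]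

lemma cuntzKriegerElement_eq_sum (a : V) [Fintype (Star a)] :
    cuntzKriegerElement K a = ContractedSemigroupRing.single K (vertex a) 1 -
      ∑ e : Star a, ContractedSemigroupRing.single K (edge e.2 * ghost e.2) 1 := by
  rw [cuntzKriegerElement, finsum_eq_sum_of_fintype]

lemma leavittSingle_vertex {a : V} [Fintype (Star a)] (ha : ¬ IsSink a) :
    leavittSingle K (vertex a) 1 = ∑ e : Star a, leavittSingle K (edge e.2 * ghost e.2) 1 := by
  have h : (cuntzKriegerIdeal V K).quotientMap (cuntzKriegerElement K a) = 0 :=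
    (cuntzKriegerIdeal V K).quotientMap_eq_zero_iff.2 <| TwoSidedIdeal.subset_span
      ⟨a, ⟨not_isEmpty_iff.1 ha, inferInstance⟩, rfl⟩
  rw [cuntzKriegerElement_eq_sum, map_sub, map_sum, sub_eq_zero] at h
  exact h

/-- Vertices are nonzero in the Leavitt path algebra, since they act as nonzero operators in the
representation given by a branching system whose branches cover. -/
lemma leavittSingle_vertex_ne_zero (a : V) : leavittSingle K (vertex a) 1 ≠ 0 := by
  obtain ⟨κ, ⟨t⟩, B, hB⟩ := BranchingSystem.exists_covering V
  obtain ⟨g, hg⟩ := ContractedSemigroupRing.exists_nonUnitalRingHom K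
    (R := Module.End K (V × κ →₀ K)) (B.rep K) (B.rep_zero K)
  have hle : cuntzKriegerIdeal V K ≤ TwoSidedIdeal.ker g := by
    refine TwoSidedIdeal.span_le.2 ?_
    rintro _ ⟨b, ⟨hb, hfin⟩, rfl⟩
    have := Fintype.ofFinite (Star b)
    refine (TwoSidedIdeal.mem_ker _).2 ?_
    rw [cuntzKriegerElement_eq_sum, map_sub, map_sum, hg, one_smul,
      B.rep_vertex_eq_sum K (hB b (not_isEmpty_iff.2 hb)), sub_eq_zero]
    exact Finset.sum_congr rfl fun e _ => by rw [hg, one_smul]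
  intro h
  have h' := (TwoSidedIdeal.mem_ker _).1
    (hle ((cuntzKriegerIdeal V K).quotientMap_eq_zero_iff.1 h))
  rw [hg, one_smul, BranchingSystem.rep_vertex] at h'
  have h1 := B.vertexOp_single K a t
  rw [h'] at h1
  simpa using DFunLike.congr_fun h1 (a, t)

variable {K} in
lemma leavitt_induction {P : LeavittPathAlgebra V K → Prop} (x : LeavittPathAlgebra V K)
    (zero : P 0) (add : ∀ x y, P x → P y → P (x + y)) (single : ∀ s k, P (leavittSingle K s k)) :
    P x := by
  obtain ⟨r, rfl⟩ := (cuntzKriegerIdeal V K).quotientMap_surjective x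
  induction r using ContractedSemigroupRing.induction_linear with
  | zero => rwa [map_zero]
  | add x y hx hy => rw [map_add]; exact add _ _ hx hy
  | single s k => exact single s k

lemma leavittGrading_eq_closure (n : ℤ) :
    leavittGrading V K n =
      AddSubgroup.closure {x | ∃ s ∈ naturalGrading V n, ∃ k : K, x = leavittSingle K s k} := by
  rw [leavittGrading, ContractedSemigroupRing.component, AddMonoidHom.map_closure]
  congr 1
  ext x
  constructor
  · rintro ⟨_, ⟨s, hs, k, rfl⟩, rfl⟩
    exact ⟨s, hs, k, rfl⟩
  · rintro ⟨s, hs, k, rfl⟩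
    exact ⟨_, ⟨s, hs, k, rfl⟩, rfl⟩

lemma leavittSingle_mem {n : ℤ} {s : GraphInverseSemigroup V} (hs : s ∈ naturalGrading V n)
    (k : K) : leavittSingle K s k ∈ leavittGrading V K n := by
  rw [leavittGrading_eq_closure]
  exact AddSubgroup.subset_closure ⟨s, hs, k, rfl⟩

/-- The ideal generated by the Cuntz–Krieger elements is homogeneous, as these have degree
zero. -/
lemma quotientMap_projection_eq_zero {x : CohnPathAlgebra V K} (hx : x ∈ cuntzKriegerIdeal V K)
    (n : ℤ) : (cuntzKriegerIdeal V K).quotientMap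
      (ContractedSemigroupRing.projection K (naturalGrading V n) x) = 0 := by
  let q := (cuntzKriegerIdeal V K).quotientMap
  let π := fun n : ℤ => ContractedSemigroupRing.projection K (naturalGrading V n)
  let J : TwoSidedIdeal (CohnPathAlgebra V K) :=
    TwoSidedIdeal.mk' {x | ∀ n, q (π n x) = 0}
      (fun n => by rw [map_zero, map_zero])
      (fun {x y} hx hy n => by rw [map_add, map_add, hx n, hy n, add_zero])
      (fun {x} hx n => by rw [map_neg, map_neg, hx n, neg_zero])
      (by
        intro x y hy
        induction x using ContractedSemigroupRing.induction_linear with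
        | zero => intro n; rw [zero_mul, map_zero, map_zero]
        | add x x' hx hx' => intro n; rw [add_mul, map_add, map_add, hx n, hx' n, add_zero]
        | single s k =>
          intro n
          obtain ⟨d, hd⟩ := (isGrading_naturalGrading V).1 s
          simp only [π]
          rw [ContractedSemigroupRing.projection_single_mul K (isGrading_naturalGrading V) hd,
            map_mul]
          exact mul_eq_zero_of_right _ (hy _))
      (by
        intro y x hy
        induction x using ContractedSemigroupRing.induction_linear with
        | zero => intro n; rw [mul_zero, map_zero, map_zero]
        | add x x' hx hx' => intro n; rw [mul_add, map_add, map_add, hx n, hx' n, add_zero]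
        | single s k =>
          intro n
          obtain ⟨d, hd⟩ := (isGrading_naturalGrading V).1 s
          simp only [π]
          rw [ContractedSemigroupRing.projection_mul_single K (isGrading_naturalGrading V) hd,
            map_mul]
          exact mul_eq_zero_of_left (hy _) _)
  have hle : cuntzKriegerIdeal V K ≤ J := by
    refine TwoSidedIdeal.span_le.2 ?_
    rintro _ ⟨a, ha, rfl⟩
    refine (TwoSidedIdeal.mem_mk' _ _ _ _ _ _ _).2 fun n => ?_
    have := ha.2
    have := Fintype.ofFinite (Star a)
    have hv : ∀ {m : ℤ}, vertex a ∈ naturalGrading V m ↔ 0 = m := fun {m} => by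
      have h := path_mul_invPath_mem_naturalGrading_iff (x := (.nil : Path a a))
        (y := (.nil : Path a a)) (n := m)
      simpa using h
    have he : ∀ (e : Star a) {m : ℤ}, edge e.2 * ghost e.2 ∈ naturalGrading V m ↔ 0 = m :=
      fun e {m} => by
        have h := path_mul_invPath_mem_naturalGrading_iff (x := e.2.toPath) (y := e.2.toPath)
          (n := m)
        simpa using h
    by_cases hn : 0 = n
    · have : π n (cuntzKriegerElement K a) = cuntzKriegerElement K a := by
        simp only [π]
        rw [cuntzKriegerElement_eq_sum, map_sub, map_sum,
          ContractedSemigroupRing.projection_single_of_mem K (hv.2 hn)]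
        congr 1
        exact Finset.sum_congr rfl fun e _ =>
          ContractedSemigroupRing.projection_single_of_mem K ((he e).2 hn) 1
      rw [this]
      exact (cuntzKriegerIdeal V K).quotientMap_eq_zero_iff.2
        (TwoSidedIdeal.subset_span ⟨a, ha, rfl⟩)
    · have : π n (cuntzKriegerElement K a) = 0 := by
        simp only [π]
        rw [cuntzKriegerElement_eq_sum, map_sub, map_sum,
          ContractedSemigroupRing.projection_single_of_notMem K (hv.not.2 hn),
          Finset.sum_eq_zero, sub_zero]
        exact fun e _ =>
          ContractedSemigroupRing.projection_single_of_notMem K ((he e).not.2 hn) 1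
      rw [this, map_zero]
  exact (TwoSidedIdeal.mem_mk' _ _ _ _ _ _ _).1 (hle hx) n

variable (V) in
lemma exists_leavittProjection (n : ℤ) :
    ∃ π : LeavittPathAlgebra V K →+ LeavittPathAlgebra V K,
      (∀ x ∈ leavittGrading V K n, π x = x) ∧
      ∀ m, m ≠ n → ∀ x ∈ leavittGrading V K m, π x = 0 := by
  let q := (cuntzKriegerIdeal V K).quotientMap
  obtain ⟨π, hπ⟩ := (cuntzKriegerIdeal V K).exists_addMonoidHom_quotientMap
    ((q : CohnPathAlgebra V K →+ LeavittPathAlgebra V K).comp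
      (ContractedSemigroupRing.projection K (naturalGrading V n)))
    fun x hx => quotientMap_projection_eq_zero K hx n
  refine ⟨π, fun x hx => ?_, fun m hm x hx => ?_⟩
  · rw [leavittGrading_eq_closure] at hx
    induction hx using AddSubgroup.closure_induction with
    | mem x hx =>
      obtain ⟨s, hs, k, rfl⟩ := hx
      refine (hπ _).trans ?_
      rw [AddMonoidHom.comp_apply, ContractedSemigroupRing.projection_single_of_mem K hs]
      rfl
    | zero => exact map_zero π
    | add x y _ _ hx hy => rw [map_add, hx, hy]
    | neg x _ hx => rw [map_neg, hx]
  · rw [leavittGrading_eq_closure] at hx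
    induction hx using AddSubgroup.closure_induction with
    | mem x hx =>
      obtain ⟨s, hs, k, rfl⟩ := hx
      by_cases hs' : s ∈ naturalGrading V n
      · have h0 : s ∈ naturalGrading V m ∩ naturalGrading V n := ⟨hs, hs'⟩
        rw [(isGrading_naturalGrading V).2.2 m n hm] at h0
        rw [h0, leavittSingle_zero, map_zero]
      · refine (hπ _).trans ?_
        rw [AddMonoidHom.comp_apply, ContractedSemigroupRing.projection_single_of_notMem K hs',
          map_zero]
    | zero => exact map_zero π
    | add x y _ _ hx hy => rw [map_add, hx, hy, add_zero]
    | neg x _ hx => rw [map_neg, hx, neg_zero]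

variable (V) in
lemma isInternal_leavittGrading : DirectSum.IsInternal (leavittGrading V K) := by
  constructor
  · rw [injective_iff_map_eq_zero]
    intro x hx
    ext n
    obtain ⟨π, h1, h2⟩ := exists_leavittProjection V K n
    have key : ∀ y, π (DirectSum.coeAddMonoidHom (leavittGrading V K) y) = y n := by
      intro y
      induction y using DirectSum.induction_on with
      | zero => simp
      | of m y =>
        rw [DirectSum.coeAddMonoidHom_of]
        by_cases hm : m = n
        · subst hm
          rw [h1 _ y.2, DirectSum.of_eq_same]
        · rw [h2 m hm _ y.2, DirectSum.of_eq_of_ne _ _ _ (Ne.symm hm)]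
          rfl
      | add y z hy hz => rw [map_add, map_add, hy, hz]; rfl
    rw [← key, hx, map_zero]
    rfl
  · intro x
    induction x using leavitt_induction with
    | zero => exact ⟨0, map_zero _⟩
    | add x y hx hy =>
      obtain ⟨x, rfl⟩ := hx
      obtain ⟨y, rfl⟩ := hy
      exact ⟨x + y, map_add _ _ _⟩
    | single s k =>
      obtain ⟨d, hd⟩ := (isGrading_naturalGrading V).1 s
      exact ⟨DirectSum.of (fun n => leavittGrading V K n) d ⟨_, leavittSingle_mem K hd k⟩,
        DirectSum.coeAddMonoidHom_of _ _ _⟩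

lemma mul_mem_leavittGrading {α β : ℤ} {x y : LeavittPathAlgebra V K}
    (hx : x ∈ leavittGrading V K α) (hy : y ∈ leavittGrading V K β) :
    x * y ∈ leavittGrading V K (α + β) := by
  rw [leavittGrading_eq_closure] at hx hy
  induction hx using AddSubgroup.closure_induction with
  | mem x hx =>
    obtain ⟨s, hs, k, rfl⟩ := hx
    induction hy using AddSubgroup.closure_induction with
    | mem y hy =>
      obtain ⟨t, ht, l, rfl⟩ := hy
      rw [leavittSingle_mul]
      exact leavittSingle_mem K ((isGrading_naturalGrading V).2.1 _ _ s hs t ht) _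
    | zero => rw [mul_zero]; exact zero_mem _
    | add y z _ _ hy hz => rw [mul_add]; exact add_mem hy hz
    | neg y _ hy => rw [mul_neg]; exact neg_mem hy
  | zero => rw [zero_mul]; exact zero_mem _
  | add y z _ _ hy hz => rw [add_mul]; exact add_mem hy hz
  | neg y _ hy => rw [neg_mul]; exact neg_mem hy

end DirectedGraph

namespace DirectedGraph

open GraphInverseSemigroup

variable {V : Type u} [Quiver.{v} V] (K : Type w) [Field K]

/-! ### Strongly graded Leavitt path algebras -/

/-- The additive subgroup generated by the `z z⁻¹` with `z` a path starting at `a` for which there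
is a path `q` with the same range and `|q| - |z| = m`. -/
noncomputable def balancedSpan (a : V) (m : ℤ) : AddSubgroup (LeavittPathAlgebra V K) :=
  AddSubgroup.closure {x | ∃ (b c : V) (z : Path a c) (q : Path b c),
    (q.length : ℤ) - z.length = m ∧ x = leavittSingle K (proj z) 1}

lemma edge_mul_mem_balancedSpan {a b : V} (e : a ⟶ b) {m : ℤ} {x : LeavittPathAlgebra V K}
    (hx : x ∈ balancedSpan K b (m + 1)) :
    leavittSingle K (edge e) 1 * x * leavittSingle K (ghost e) 1 ∈ balancedSpan K a m := by
  induction hx using AddSubgroup.closure_induction with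
  | mem x hx =>
    obtain ⟨c, d, z, q, hm, rfl⟩ := hx
    refine AddSubgroup.subset_closure ⟨c, d, e.toPath.comp z, q, ?_, ?_⟩
    · rw [Path.length_comp, Path.length_toPath]; push_cast; omega
    · rw [leavittSingle_mul, leavittSingle_mul, proj, proj, path_comp, invPath_comp, path_toPath,
        invPath_toPath]
      simp only [mul_assoc, one_mul]
  | zero => rw [mul_zero, zero_mul]; exact zero_mem _
  | add x y _ _ hx hy => rw [mul_add, add_mul]; exact add_mem hx hy
  | neg x _ hx => rw [mul_neg, neg_mul]; exact neg_mem hx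

/-- A compactness argument: if some vertex were not a sum of balanced idempotents, then by the
Cuntz–Krieger relations the same would hold for the range of one of its edges, and so on along an
infinite path, in contradiction to condition (Y). -/
lemma vertex_mem_balancedSpan (hs : ∀ a : V, ¬ IsSink a) (hr : RowFinite V) (hY : ConditionY V)
    (a : V) (m : ℤ) : leavittSingle K (vertex a) 1 ∈ balancedSpan K a m := by
  by_contra ha
  obtain ⟨p, -, hp⟩ := InfinitePath.exists_of_forall_exists_edge (a := a)
    (P := fun b k => leavittSingle K (vertex b) 1 ∉ balancedSpan K b (m + k)) (by simpa using ha)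
    (by
      intro b k hb
      by_contra! hcon
      apply hb
      have := hr b
      have := Fintype.ofFinite (Star b)
      rw [leavittSingle_vertex K (hs b)]
      refine sum_mem fun e _ => ?_
      have h := hcon e.1 e.2
      push_cast at h
      rw [← add_assoc] at h
      have h' := edge_mul_mem_balancedSpan K e.2 h
      rwa [leavittSingle_mul, leavittSingle_mul, one_mul, one_mul, edge_mul_vertex] at h')
  obtain ⟨k, b, y, hy⟩ := hY.exists_int m p
  refine hp k (AddSubgroup.subset_closure ⟨b, _, .nil, y, ?_, ?_⟩)
  · rw [Path.length_nil]; push_cast; omega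
  · rw [proj_nil]

lemma isStronglyGradedRing_of_conditionY (hs : ∀ a : V, ¬ IsSink a) (hr : RowFinite V)
    (hY : ConditionY V) : IsStronglyGradedRing (leavittGrading V K) := by
  refine ⟨isInternal_leavittGrading V K, fun α β => le_antisymm ?_ ?_⟩
  · rw [AddSubgroup.closure_le]
    rintro _ ⟨a, ha, b, hb, rfl⟩
    exact mul_mem_leavittGrading K ha hb
  · conv_lhs => rw [leavittGrading_eq_closure]
    rw [AddSubgroup.closure_le]
    rintro _ ⟨s, hs', k, rfl⟩
    rcases hs' with rfl | ⟨a, b, c, x, y, rfl, hxy⟩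
    · rw [leavittSingle_zero]; exact zero_mem _
    -- `x y⁻¹ = ∑ x z z⁻¹ y⁻¹ = ∑ (x z q⁻¹) (q z⁻¹ y⁻¹)`
    have key : ∀ w ∈ balancedSpan K c (x.length - α),
        leavittSingle K (path x) k * w * leavittSingle K (invPath y) 1 ∈
          AddSubgroup.closure {r | ∃ a ∈ leavittGrading V K α, ∃ b ∈ leavittGrading V K β,
            r = a * b} := by
      intro w hw
      induction hw using AddSubgroup.closure_induction with
      | mem w hw =>
        obtain ⟨b', d, z, q, hq, rfl⟩ := hw
        refine AddSubgroup.subset_closure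
          ⟨leavittSingle K (path (x.comp z) * invPath q) k, leavittSingle_mem K ?_ k,
            leavittSingle K (path q * invPath (y.comp z)) 1, leavittSingle_mem K ?_ 1, ?_⟩
        · rw [path_mul_invPath_mem_naturalGrading_iff, Path.length_comp]; push_cast; omega
        · rw [path_mul_invPath_mem_naturalGrading_iff, Path.length_comp]; push_cast; omega
        · rw [leavittSingle_mul, leavittSingle_mul, leavittSingle_mul, mul_one, mul_one, proj,
            mul_assoc (path (x.comp z)), ← mul_assoc (invPath q), invPath_mul_path,
            vertex_mul_invPath, path_comp, invPath_comp]
          simp only [mul_assoc]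
      | zero => rw [mul_zero, zero_mul]; exact zero_mem _
      | add x y _ _ hx hy => rw [mul_add, add_mul]; exact add_mem hx hy
      | neg x _ hx => rw [mul_neg, neg_mul]; exact neg_mem hx
    have h := key _ (vertex_mem_balancedSpan K hs hr hY c _)
    rwa [leavittSingle_mul, leavittSingle_mul, path_mul_vertex, mul_one, mul_one] at h

variable {K}

/-- An element of `L_α L_β` is annihilated by every `t` that annihilates a suitable finite set of
elements of the graph inverse semigroup of degree `α`. -/
lemma exists_finset_of_mem_closure {α β : ℤ} {x : LeavittPathAlgebra V K}
    (hx : x ∈ AddSubgroup.closure {r | ∃ a ∈ leavittGrading V K α, ∃ b ∈ leavittGrading V K β,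
      r = a * b}) :
    ∃ F : Finset (GraphInverseSemigroup V), (∀ s ∈ F, s ∈ naturalGrading V α) ∧
      ∀ t, (∀ s ∈ F, t * s = 0) → leavittSingle K t 1 * x = 0 := by
  classical
  have hadd : ∀ x y : LeavittPathAlgebra V K,
      (∃ F : Finset (GraphInverseSemigroup V), (∀ s ∈ F, s ∈ naturalGrading V α) ∧
        ∀ t, (∀ s ∈ F, t * s = 0) → leavittSingle K t 1 * x = 0) →
      (∃ F : Finset (GraphInverseSemigroup V), (∀ s ∈ F, s ∈ naturalGrading V α) ∧
        ∀ t, (∀ s ∈ F, t * s = 0) → leavittSingle K t 1 * y = 0) →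
      ∃ F : Finset (GraphInverseSemigroup V), (∀ s ∈ F, s ∈ naturalGrading V α) ∧
        ∀ t, (∀ s ∈ F, t * s = 0) → leavittSingle K t 1 * (x + y) = 0 := by
    rintro x y ⟨F, hF, hx⟩ ⟨G, hG, hy⟩
    refine ⟨F ∪ G, fun s hs => (Finset.mem_union.1 hs).elim (hF s) (hG s), fun t ht => ?_⟩
    rw [mul_add, hx t fun s hs => ht s (Finset.mem_union_left _ hs),
      hy t fun s hs => ht s (Finset.mem_union_right _ hs), add_zero]
  have hzero : ∃ F : Finset (GraphInverseSemigroup V), (∀ s ∈ F, s ∈ naturalGrading V α) ∧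
      ∀ t, (∀ s ∈ F, t * s = 0) → leavittSingle K t 1 * 0 = 0 :=
    ⟨∅, by simp, fun t _ => mul_zero _⟩
  have hneg : ∀ x : LeavittPathAlgebra V K,
      (∃ F : Finset (GraphInverseSemigroup V), (∀ s ∈ F, s ∈ naturalGrading V α) ∧
        ∀ t, (∀ s ∈ F, t * s = 0) → leavittSingle K t 1 * x = 0) →
      ∃ F : Finset (GraphInverseSemigroup V), (∀ s ∈ F, s ∈ naturalGrading V α) ∧
        ∀ t, (∀ s ∈ F, t * s = 0) → leavittSingle K t 1 * -x = 0 := by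
    rintro x ⟨F, hF, hx⟩
    exact ⟨F, hF, fun t ht => by rw [mul_neg, hx t ht, neg_zero]⟩
  have hleft : ∀ a ∈ leavittGrading V K α,
      ∃ F : Finset (GraphInverseSemigroup V), (∀ s ∈ F, s ∈ naturalGrading V α) ∧
        ∀ t, (∀ s ∈ F, t * s = 0) → leavittSingle K t 1 * a = 0 := by
    intro a ha
    rw [leavittGrading_eq_closure] at ha
    induction ha using AddSubgroup.closure_induction with
    | mem a ha =>
      obtain ⟨s, hs, k, rfl⟩ := ha
      refine ⟨{s}, fun s' hs' => by rwa [Finset.mem_singleton.1 hs'], fun t ht => ?_⟩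
      rw [leavittSingle_mul, ht s (Finset.mem_singleton_self s), leavittSingle_zero]
    | zero => exact hzero
    | add x y _ _ hx hy => exact hadd x y hx hy
    | neg x _ hx => exact hneg x hx
  induction hx using AddSubgroup.closure_induction with
  | mem x hx =>
    obtain ⟨a, ha, b, -, rfl⟩ := hx
    obtain ⟨F, hF, h⟩ := hleft a ha
    exact ⟨F, hF, fun t ht => by rw [← mul_assoc, h t ht, zero_mul]⟩
  | zero => exact hzero
  | add x y _ _ hx hy => exact hadd x y hx hy
  | neg x _ hx => exact hneg x hx

/-- For every vertex `a` of a graph with strongly graded Leavitt path algebra there is a finite set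
of elements of degree `α` that is not annihilated by any `x⁻¹` with `x` a path starting at `a`. -/
lemma exists_finset_of_isStronglyGradedRing (h : IsStronglyGradedRing (leavittGrading V K))
    (a : V) (α : ℤ) :
    ∃ F : Finset (GraphInverseSemigroup V), (∀ s ∈ F, s ∈ naturalGrading V α) ∧
      ∀ (b : V) (x : Path a b), ∃ s ∈ F, invPath x * s ≠ 0 := by
  have hmem : leavittSingle K (vertex a) 1 ∈ leavittGrading V K (α + -α) :=
    leavittSingle_mem K (.inr ⟨a, a, a, .nil, .nil, (vertex_mul_vertex a).symm, by simp⟩) 1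
  rw [← h.2 α (-α)] at hmem
  obtain ⟨F, hF, hann⟩ := exists_finset_of_mem_closure hmem
  refine ⟨F, hF, fun b x => ?_⟩
  by_contra! hx
  have h1 := hann (invPath x) hx
  rw [leavittSingle_mul, invPath_mul_vertex, one_mul] at h1
  have h2 : leavittSingle K (invPath x) 1 * leavittSingle K (path x) 1 = 0 := by
    rw [h1, zero_mul]
  rw [leavittSingle_mul, invPath_mul_path, one_mul] at h2
  exact leavittSingle_vertex_ne_zero K b h2

lemma not_isSink_of_isStronglyGradedRing (h : IsStronglyGradedRing (leavittGrading V K)) (a : V) :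
    ¬ IsSink a := by
  intro ha
  obtain ⟨F, hF, hx⟩ := exists_finset_of_isStronglyGradedRing h a 1
  obtain ⟨s, hs, hne⟩ := hx a .nil
  exact hne (vertex_mul_eq_zero_of_isSink ha (hF s hs))

/-- An element of positive degree begins with an edge, so it is annihilated by the inverses of all
other edges. -/
lemma subsingleton_setOf_ghost_mul_ne_zero (a : V) {s : GraphInverseSemigroup V}
    (hs : s ∈ naturalGrading V 1) : {e : Star a | ghost e.2 * s ≠ 0}.Subsingleton := by
  rintro ⟨b, e⟩ he ⟨c, f⟩ hf
  rcases hs with rfl | ⟨a', b', c', x, y, rfl, hxy⟩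
  · exact absurd (mul_zero _) he
  rcases path_eq_nil_or_eq_toPath_comp x with ⟨rfl, rfl⟩ | ⟨d, g, z, rfl⟩
  · simp only [Path.length_nil] at hxy
    omega
  · have key : ∀ {b : V} (e : a ⟶ b), ghost e * (path (g.toPath.comp z) * invPath y) ≠ 0 →
        Total.mk _ _ e = Total.mk _ _ g := by
      intro b e he
      by_contra hne
      rw [path_comp, path_toPath, ← mul_assoc, ← mul_assoc, ghost_mul_edge_of_ne hne, zero_mul,
        zero_mul] at he
      exact he rfl
    have h1 := (key e he).trans (key f hf).symm
    cases h1
    rfl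

lemma rowFinite_of_isStronglyGradedRing (h : IsStronglyGradedRing (leavittGrading V K)) :
    RowFinite V := by
  intro a
  obtain ⟨F, hF, hx⟩ := exists_finset_of_isStronglyGradedRing h a 1
  have hfin : (⋃ s ∈ F, {e : Star a | ghost e.2 * s ≠ 0}).Finite :=
    F.finite_toSet.biUnion fun s hs => (subsingleton_setOf_ghost_mul_ne_zero a (hF s hs)).finite
  refine Set.finite_univ_iff.1 (hfin.subset fun e _ => ?_)
  obtain ⟨s, hs, hne⟩ := hx e.1 e.2.toPath
  rw [invPath_toPath] at hne
  exact Set.mem_biUnion hs hne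

lemma conditionY_of_isStronglyGradedRing (h : IsStronglyGradedRing (leavittGrading V K)) :
    ConditionY V := by
  intro n p
  by_contra! hcon
  obtain ⟨F, hF, hx⟩ := exists_finset_of_isStronglyGradedRing h (p.vertex 0) (-n)
  -- an element `x y⁻¹` of degree `-n` that survives multiplication by long initial subpaths of `p`
  -- is one for which `x` is an initial subpath of `p`, so that `y` verifies the condition
  have key : ∀ s ∈ F, ∀ᶠ k in Filter.atTop, invPath (p.initial k) * s = 0 := by
    intro s hs
    rcases hF s hs with rfl | ⟨a, b, c, x, y, rfl, hxy⟩
    · simp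
    filter_upwards [Filter.eventually_ge_atTop x.length] with k hk
    rcases invPath_mul_path_cases (p.initial k) x with h0 | ⟨z, hz⟩ | ⟨z, hz⟩
    · rw [← mul_assoc, h0, zero_mul]
    · cases hz
      rw [Path.length_comp, InfinitePath.length_initial] at hk hxy
      obtain ⟨a', y', hy'⟩ : ∃ (a' : V) (y' : Path a' (p.vertex k)), y'.length = y.length := by
        cases z with
        | nil => exact ⟨_, y, rfl⟩
        | cons z e => rw [Path.length_cons] at hk; omega
      exact absurd (by rw [InfinitePath.length_initial]; omega) (hcon k a' y')
    · obtain ⟨rfl, hz⟩ := Sigma.mk.inj hz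
      obtain ⟨a', y', hy'⟩ := exists_path_to_vertex p (eq_of_heq hz) y
      exact absurd (by rw [InfinitePath.length_initial]; omega) (hcon _ a' y')
  obtain ⟨k, hk⟩ := ((Filter.eventually_all_finset F).2 key).exists
  obtain ⟨s, hs, hne⟩ := hx _ (p.initial k)
  exact hne (hk s hs)

end DirectedGraph

theorem theorem7p9 (V : Type u) [Quiver.{v} V] [Nonempty V] :
    List.TFAE [
      (∀ a : V, ¬ IsSink a) ∧ RowFinite V ∧ ConditionY V,
      ∀ (K : Type w) [Field K], IsStronglyGradedRing (leavittGrading V K),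
      (∀ s : GraphInverseSemigroup V, ¬ IsMinimalNonzeroIdempotent s) ∧
        MaximalIdempotentFiniteness (GraphInverseSemigroup V) ∧
        SaturatedStronglyGraded (GraphInverseSemigroup.naturalGrading V),
      MaximalIdempotentFiniteness (GraphInverseSemigroup V) ∧
        LocallyStronglyGraded (GraphInverseSemigroup.naturalGrading V) ∧
        SaturatedStronglyGraded (GraphInverseSemigroup.naturalGrading V)] := by
  rw [GraphInverseSemigroup.forall_not_isMinimalNonzeroIdempotent_iff,
    GraphInverseSemigroup.maximalIdempotentFiniteness_iff_rowFinite,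
    GraphInverseSemigroup.saturatedStronglyGraded_iff_conditionY]
  tfae_have 1 → 2 := fun ⟨hs, hr, hY⟩ K _ => isStronglyGradedRing_of_conditionY K hs hr hY
  tfae_have 2 → 1 := fun h =>
    ⟨not_isSink_of_isStronglyGradedRing (h (ULift.{w} ℚ)),
      rowFinite_of_isStronglyGradedRing (h (ULift.{w} ℚ)),
      conditionY_of_isStronglyGradedRing (h (ULift.{w} ℚ))⟩
  tfae_have 1 ↔ 3 := Iff.rfl
  tfae_have 1 → 4 := fun ⟨hs, hr, hY⟩ =>
    ⟨hr, GraphInverseSemigroup.locallyStronglyGraded_of_conditionY hs hY, hY⟩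
  tfae_have 4 → 1 := fun ⟨hr, hl, hY⟩ =>
    ⟨GraphInverseSemigroup.not_isSink_of_locallyStronglyGraded hl, hr, hY⟩
  tfae_finish
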